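/- Let a signature $\sigma$ be a finite set of relation symbols $R$ with arities $\mathsf{ar}(R)$. For a finite relational structure $\mathcal{H}$ of signature $\sigma$, with universe $V(\mathcal{H})$ and relations $R(\mathcal{H})\subseteq V(\mathcal{H})^{\mathsf{ar}(R)}$, let $$\|\mathcal{H}\| = |\sigma| + |V(\mathcal{H})| + \sum_{R\in\sigma} |R(\mathcal{H})|\cdot \mathsf{ar}(R).$$ A homomorphism $\mathcal{G}\to\mathcal{H}$ of structures of the same signature $\sigma$ is a map $f:V(\mathcal{G})\to V(\mathcal{H})$ such that for every $R\in\sigma$ and every $\mathbf{x}\in R(\mathcal{G})$ the entrywise image $f(\mathbf{x})$ lies in $R(\mathcal{H})$. An ordered graph is a finite simple graph with a linearly ordered vertex set, and an ordered homomorphism $G\to H$ of ordered graphs is a map $V(G)\to V(H)$ that maps edges to edges and satisfies $f(u)\le f(v)$ whenever $u\le v$. Theorem. There is an algorithm that, given two finite relational structures $\mathcal{G},\mathcal{H}$ of the same signature $\sigma$ (with $\sigma$ part of the input), constructs, in time polynomial in $\|\mathcal{G}\|+\|\mathcal{H}\|$, a pair of ordered bipartite graphs $G,H$ such that there is a homomorphism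 $\mathcal{G}\to\mathcal{H}$ if and only if there is an ordered homomorphism $G\to H$. -/

import Mathlib

universe u v x y

/-! ### Random access machines

A program works on registers `0, 1, 2, …` and arrays `0, 1, 2, …`, all of whose cells hold natural
numbers. Its instructions are: load a constant, add, subtract (truncated at `0`), read or write an
array cell whose index stands in a register, and compare two registers. Every executed instruction
and every evaluated test costs one step. There is no multiplication, so that in `t` steps numbers
grow by at most `t + O(1)` bits, and polynomially many steps mean polynomial time in the usual
(Turing machine) sense. -/

namespace RAM

/-- Programs. Registers and arrays are named by numbers that are fixed in the program text. -/
inductive Prog : Type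
  /-- register `r` := the constant `c` -/
  | const (r c : ℕ) : Prog
  /-- register `r` := register `a` + register `b` -/
  | add (r a b : ℕ) : Prog
  /-- register `r` := register `a` - register `b`, or `0` if this is negative -/
  | sub (r a b : ℕ) : Prog
  /-- register `r` := the cell of the array `arr` whose index is in register `a` -/
  | load (r arr a : ℕ) : Prog
  /-- the cell of the array `arr` whose index is in register `a` := register `b` -/
  | store (arr a b : ℕ) : Prog
  /-- first `p`, then `q` -/
  | seq (p q : Prog) : Prog
  /-- if register `a` < register `b` then `p` else `q` -/
  | ifLt (a b : ℕ) (p q : Prog) : Prog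
  /-- while register `a` < register `b` do `p` -/
  | whileLt (a b : ℕ) (p : Prog) : Prog

/-- The contents of the registers and of the arrays: `mem arr i` is cell `i` of array `arr`. -/
structure State : Type where
  reg : ℕ → ℕ
  mem : ℕ → ℕ → ℕ

/-- Write `c` into register `r`. -/
def State.setReg (s : State) (r c : ℕ) : State where
  reg := Function.update s.reg r c
  mem := s.mem

/-- Write `c` into cell `i` of array `arr`. -/
def State.setMem (s : State) (arr i c : ℕ) : State where
  reg := s.reg
  mem := Function.update s.mem arr (Function.update (s.mem arr) i c)

/-- `p.Exec s t s'`: started in state `s`, the program `p` halts after exactly `t` steps, in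
state `s'`. -/
inductive Prog.Exec : Prog → State → ℕ → State → Prop
  | const (s : State) (r c : ℕ) : Exec (.const r c) s 1 (s.setReg r c)
  | add (s : State) (r a b : ℕ) : Exec (.add r a b) s 1 (s.setReg r (s.reg a + s.reg b))
  | sub (s : State) (r a b : ℕ) : Exec (.sub r a b) s 1 (s.setReg r (s.reg a - s.reg b))
  | load (s : State) (r arr a : ℕ) : Exec (.load r arr a) s 1 (s.setReg r (s.mem arr (s.reg a)))
  | store (s : State) (arr a b : ℕ) :
      Exec (.store arr a b) s 1 (s.setMem arr (s.reg a) (s.reg b))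
  | seq {p q : Prog} {s₀ s₁ s₂ : State} {t₁ t₂ : ℕ} :
      Exec p s₀ t₁ s₁ → Exec q s₁ t₂ s₂ → Exec (.seq p q) s₀ (t₁ + t₂) s₂
  | ifLt_true {a b : ℕ} {p q : Prog} {s s' : State} {t : ℕ} :
      s.reg a < s.reg b → Exec p s t s' → Exec (.ifLt a b p q) s (1 + t) s'
  | ifLt_false {a b : ℕ} {p q : Prog} {s s' : State} {t : ℕ} :
      ¬ s.reg a < s.reg b → Exec q s t s' → Exec (.ifLt a b p q) s (1 + t) s'
  | whileLt_true {a b : ℕ} {p : Prog} {s₀ s₁ s₂ : State} {t₁ t₂ : ℕ} :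
      s₀.reg a < s₀.reg b → Exec p s₀ t₁ s₁ → Exec (.whileLt a b p) s₁ t₂ s₂ →
        Exec (.whileLt a b p) s₀ (1 + t₁ + t₂) s₂
  | whileLt_false {a b : ℕ} {p : Prog} {s : State} :
      ¬ s.reg a < s.reg b → Exec (.whileLt a b p) s 1 s

/-- The initial state for the inputs `v`, `w`: array `0` starts with `v`, array `1` starts with `w`,
and all other cells and all registers are `0`. -/
def State.init (v w : List ℕ) : State where
  reg := fun _ => 0
  mem := fun arr i => if arr = 0 then v.getD i 0 else if arr = 1 then w.getD i 0 else 0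

/-- In the state `s` the array `arr` starts with the word `w`. -/
def State.Holds (s : State) (arr : ℕ) (w : List ℕ) : Prop :=
  ∀ (i : ℕ) (hi : i < w.length), s.mem arr i = w[i]

end RAM

/-! ### Relational structures -/

/-- The size `‖M‖ = |σ| + |V(M)| + ∑_{R ∈ σ} |R(M)| · ar(R)` of a finite relational structure. -/
noncomputable def structureSize (L : FirstOrder.Language) [Fintype (Σ l, L.Relations l)]
    (M : Type*) [L.Structure M] : ℕ :=
  Fintype.card (Σ l, L.Relations l) + Nat.card M +
    ∑ R : (Σ l, L.Relations l),
      {x : Fin R.1 → M | FirstOrder.Language.Structure.RelMap R.2 x}.ncard * R.1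

/-- The word `w` describes the relational structure `M`, with respect to the numbering `sym` of the
relation symbols: it consists of the number `k` of symbols, the number `n` of elements of `M`, and,
for each symbol in turn, its arity, the number of tuples in its relation, and these tuples one after
the other, in some order and without repetition, each as the list of the numbers of its entries in
some numbering of the elements of `M`. -/
def EncodesStructure {L : FirstOrder.Language} {k : ℕ} (sym : Fin k ≃ Σ l, L.Relations l)
    (M : Type*) [L.Structure M] (w : List ℕ) : Prop :=
  ∃ (n : ℕ) (vert : M ≃ Fin n) (tuples : (j : Fin k) → List (Fin (sym j).1 → M)),
    (∀ j, (tuples j).Nodup ∧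
      ∀ x, x ∈ tuples j ↔ FirstOrder.Language.Structure.RelMap (sym j).2 x) ∧
    w = k :: n :: (List.finRange k).flatMap fun j =>
      (sym j).1 :: (tuples j).length ::
        (tuples j).flatMap fun x => List.ofFn fun i => (vert (x i) : ℕ)

/-! ### Ordered graphs -/

/-- The existence of a homomorphism of ordered graphs: a graph homomorphism that preserves the
orderings of the vertices. -/
def OrderedHom {V W : Type*} [LinearOrder V] [LinearOrder W] (G : SimpleGraph V)
    (H : SimpleGraph W) : Prop :=
  ∃ f : G →g H, Monotone f

/-- The word `w` describes the ordered graph `G` with vertices `0 < 1 < … < n - 1`: it consists of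
`n`, the length of a list of edges, and this list, in which every edge of `G` occurs (in one of its
two orientations, possibly repeatedly) and nothing else. -/
def EncodesGraph {n : ℕ} (G : SimpleGraph (Fin n)) (w : List ℕ) : Prop :=
  ∃ edges : List (Fin n × Fin n),
    (∀ u v, G.Adj u v ↔ (u, v) ∈ edges ∨ (v, u) ∈ edges) ∧
    w = n :: edges.length :: edges.flatMap fun e => [(e.1 : ℕ), (e.2 : ℕ)]

/-! The reduction passes through a binary constraint problem on the variables 0, …, S with values
below Z. Such a problem becomes a pair of ordered graphs as follows. G is the path 0, 1, …, S plus
one edge per constrained pair. H consists of S + 1 consecutive blocks of Z vertices, with all edges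
between neighbouring blocks and one edge per allowed pair of values. Constraints join an even
variable to an odd one, so every edge of H joins blocks of different parity. An ordered homomorphism
therefore strictly increases the block number at each step of the path. With S steps and S + 1
blocks, vertex p must land in block p, and its place in the block is a value for the variable p.
Constrained variables are never neighbours on the path, so the edges between neighbouring blocks
cannot satisfy a constraint. This is `IsParityConstraint.orderedHom_iff`; parity also colours both
graphs with two colours.

For two structures, the variables are the elements and the tuples of the first one, and their values
are elements and tuples of the second one. That the image of a tuple has the images of its entries
as entries would be a constraint between two even variables. An odd variable for each entry is put
between them. Residues modulo 8 separate the kinds of variables and keep constrained variables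
apart; see `HomData.IsBounded.isParityConstraint` and `HomData.IsBounded.exists_assignment_iff`.
`HomData.Describes.exists_isHom_iff` returns from numbers to structures.

The edge lists are unions of explicit families over nested ranges, so they are produced by a small
loop language whose compiler is verified once, in `RAM.Cmd.exec_compile`. Its running time is
polynomial in a bound on the lengths of the loops. All loops have length at most a fixed polynomial
in Z (`RAM.Cmd.bdd_homCmd`), and Z is linear in the size of the input (`RAM.Reads.inputBound_le`).
-/

namespace RAM

/-! ### Programs that emit lists of pairs

Closed arithmetical terms with bounded recursion, and commands that emit pairs of numbers in nested
loops, with a compiler to RAM programs. -/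

/-- Terms over a list of variables and the two input words. -/
inductive Term : Type
  | var (i : ℕ) : Term
  | const (c : ℕ) : Term
  | add (e f : Term) : Term
  /-- a cell of one of the two input words -/
  | load (b : Bool) (e : Term) : Term
  /-- `fold n e`: start with `0` and apply `n` times the function that is given by `e`, whose last
  two variables are the number of the iteration and the current value -/
  | fold (n e : Term) : Term

/-- The inputs in a state. -/
def State.input (s : State) (b : Bool) (i : ℕ) : ℕ := s.mem b.toNat i

def Term.eval (inp : Bool → ℕ → ℕ) : Term → List ℕ → ℕ
  | .var i, env => env.getD i 0
  | .const c, _ => c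
  | .add e f, env => e.eval inp env + f.eval inp env
  | .load b e, env => inp b (e.eval inp env)
  | .fold n e, env => Nat.rec (motive := fun _ => ℕ) 0 (fun j x => e.eval inp (env ++ [j, x]))
      (n.eval inp env)

/-- All loops that occur in the evaluation of a term run at most `B` times. -/
def Term.Bdd (inp : Bool → ℕ → ℕ) (B : ℕ) : Term → List ℕ → Prop
  | .var _, _ => True
  | .const _, _ => True
  | .add e f, env => e.Bdd inp B env ∧ f.Bdd inp B env
  | .load _ e, env => e.Bdd inp B env
  | .fold n e, env => n.Bdd inp B env ∧ n.eval inp env ≤ B ∧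
      ∀ j < n.eval inp env, e.Bdd inp B (env ++ [j, (Term.fold (.const j) e).eval inp env])

/-- An upper bound on the evaluation time, as a polynomial in the bound on the loops. -/
noncomputable def Term.time : Term → Polynomial ℕ
  | .var _ => 2
  | .const _ => 1
  | .add e f => e.time + f.time + 1
  | .load _ e => e.time + 1
  | .fold n e => n.time + 5 + Polynomial.X * (e.time + 5)

/-- `e.compile Γ w` evaluates `e`, with the variables in the registers `Γ`, into register `w`, and
changes no register below `w`. -/
def Term.compile : Term → List ℕ → ℕ → Prog
  | .var i, Γ, w =>
    match Γ[i]? with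
    -- A register is copied by adding a register that holds 0, since the machine has no move
    -- instruction.
    | some r => .seq (.const w 0) (.add w r w)
    | none => .const w 0
  | .const c, _, w => .const w c
  | .add e f, Γ, w => .seq (e.compile Γ w) (.seq (f.compile Γ (w + 1)) (.add w w (w + 1)))
  | .load b e, Γ, w => .seq (e.compile Γ w) (.load w b.toNat w)
  | .fold n e, Γ, w =>
    .seq (n.compile Γ w) (.seq (.const (w + 1) 0) (.seq (.const (w + 2) 0) (.seq
      (.whileLt (w + 1) w
        (.seq (e.compile (Γ ++ [w + 1, w + 2]) (w + 3))
          (.seq (.const (w + 4) 0) (.seq (.add (w + 2) (w + 3) (w + 4))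
            (.seq (.const (w + 3) 1) (.add (w + 1) (w + 1) (w + 3)))))))
      (.seq (.const (w + 3) 0) (.add w (w + 2) (w + 3))))))

/-- The invariant rule for counting loops. The invariant fixes the counter and the limit, so the
number of rounds is known in advance, and each round costs the body plus one test. -/
theorem Prog.Exec.of_count {a b : ℕ} {p : Prog} {I : ℕ → State → Prop} {N T : ℕ}
    (hI : ∀ j s, I j s → s.reg a = j ∧ s.reg b = N)
    (hp : ∀ j < N, ∀ s, I j s → ∃ t s', p.Exec s t s' ∧ t ≤ T ∧ I (j + 1) s')
    {s : State} (hs : I 0 s) :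
    ∃ t s', (Prog.whileLt a b p).Exec s t s' ∧ t ≤ N * (T + 1) + 1 ∧ I N s' := by
  have key : ∀ d j, j + d = N → ∀ s, I j s →
      ∃ t s', (Prog.whileLt a b p).Exec s t s' ∧ t ≤ d * (T + 1) + 1 ∧ I N s' := by
    intro d
    induction d with
    | zero =>
      intro j hj s hs
      obtain rfl : j = N := by simpa using hj
      exact ⟨1, s, .whileLt_false (by rw [(hI _ _ hs).1, (hI _ _ hs).2]; exact lt_irrefl _),
        by omega, hs⟩
    | succ d ih =>
      intro j hj s hs
      obtain ⟨t, s', h, ht, hs'⟩ := hp j (by omega) s hs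
      obtain ⟨t₂, s₂, h₂, ht₂, hs₂⟩ := ih (j + 1) (by omega) s' hs'
      refine ⟨1 + t + t₂, s₂, .whileLt_true ?_ h h₂, ?_, hs₂⟩
      · rw [(hI _ _ hs).1, (hI _ _ hs).2]; omega
      · rw [Nat.add_mul]; omega
  exact key N 0 (by omega) s hs

theorem State.setReg_reg (s : State) (r c q : ℕ) :
    (s.setReg r c).reg q = if q = r then c else s.reg q := by
  simp [State.setReg, Function.update_apply]

theorem State.setReg_mem (s : State) (r c : ℕ) : (s.setReg r c).mem = s.mem := rfl

theorem State.setMem_reg (s : State) (a i c : ℕ) : (s.setMem a i c).reg = s.reg := rfl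

theorem State.setMem_mem (s : State) (a i c a' i' : ℕ) :
    (s.setMem a i c).mem a' i' = if a' = a ∧ i' = i then c else s.mem a' i' := by
  by_cases h : a' = a
  · subst h; simp [State.setMem, Function.update_apply]
  · simp [State.setMem, h]

theorem State.input_congr {s s' : State} (h : s'.mem = s.mem) : s'.input = s.input := by
  unfold State.input; rw [h]

theorem map_reg_congr {s s' : State} {Γ : List ℕ} {w : ℕ} (hΓ : ∀ r ∈ Γ, r < w)
    (h : ∀ r < w, s'.reg r = s.reg r) : Γ.map s'.reg = Γ.map s.reg :=
  List.map_congr_left fun r hr => h r (hΓ r hr)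

/-- Registers from `w` on serve as a stack. Preservation of everything below `w` keeps both the
variables and the pending intermediate results intact, which is what the induction needs. -/
theorem Term.exec_compile (e : Term) : ∀ (Γ : List ℕ) (w : ℕ) (s : State) (B : ℕ),
    (∀ r ∈ Γ, r < w) → e.Bdd s.input B (Γ.map s.reg) →
    ∃ t s', (e.compile Γ w).Exec s t s' ∧ t ≤ e.time.eval B ∧ s'.mem = s.mem ∧
      s'.reg w = e.eval s.input (Γ.map s.reg) ∧ ∀ r < w, s'.reg r = s.reg r := by
  induction e with
  | var i =>
    intro Γ w s B hΓ _
    cases h : Γ[i]? with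
    | none =>
      have hc : (Term.var i).compile Γ w = .const w 0 := by simp only [Term.compile, h]
      rw [hc]
      refine ⟨1, _, .const s w 0, ?_, rfl, ?_, ?_⟩
      · simp [Term.time]
      · simp [State.setReg, Term.eval, List.getD_eq_getElem?_getD, h]
      · intro r hr; simp [State.setReg_reg, hr.ne]
    | some q =>
      have hq : q < w := hΓ q (List.mem_of_getElem? h)
      have hc : (Term.var i).compile Γ w = .seq (.const w 0) (.add w q w) := by
        simp only [Term.compile, h]
      rw [hc]
      refine ⟨1 + 1, _, .seq (.const s w 0) (.add _ w q w), ?_, rfl, ?_, ?_⟩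
      · simp [Term.time]
      · simp [State.setReg_reg, Term.eval, List.getD_eq_getElem?_getD, h, hq.ne]
      · intro r hr; simp [State.setReg_reg, hr.ne]
  | const c =>
    intro Γ w s B hΓ _
    refine ⟨1, _, .const s w c, ?_, rfl, ?_, ?_⟩
    · simp [Term.time]
    · simp [State.setReg, Term.eval]
    · intro r hr; simp [State.setReg_reg, hr.ne]
  | add e f ihe ihf =>
    intro Γ w s B hΓ hB
    obtain ⟨t₁, s₁, h₁, ht₁, hm₁, hv₁, hr₁⟩ := ihe Γ w s B hΓ hB.1
    have hΓ₁ := map_reg_congr hΓ hr₁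
    have hi₁ := State.input_congr hm₁
    obtain ⟨t₂, s₂, h₂, ht₂, hm₂, hv₂, hr₂⟩ := ihf Γ (w + 1) s₁ B
      (fun r hr => (hΓ r hr).trans (Nat.lt_succ_self _)) (by rw [hΓ₁, hi₁]; exact hB.2)
    refine ⟨_, _, .seq h₁ (.seq h₂ (.add _ _ _ _)), ?_, hm₂.trans hm₁, ?_, ?_⟩
    · simp only [Term.time, Polynomial.eval_add, Polynomial.eval_one]; omega
    · rw [State.setReg_reg, if_pos rfl, hr₂ w (Nat.lt_succ_self _), hv₁, hv₂, hΓ₁, hi₁, Term.eval]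
    · intro r hr
      rw [State.setReg_reg, if_neg hr.ne, hr₂ r (by omega), hr₁ r hr]
  | load b e ih =>
    intro Γ w s B hΓ hB
    obtain ⟨t₁, s₁, h₁, ht₁, hm₁, hv₁, hr₁⟩ := ih Γ w s B hΓ hB
    refine ⟨_, _, .seq h₁ (.load _ _ _ _), ?_, hm₁, ?_, ?_⟩
    · simp only [Term.time, Polynomial.eval_add, Polynomial.eval_one]; omega
    · rw [State.setReg_reg, if_pos rfl, hv₁, hm₁]; rfl
    · intro r hr
      rw [State.setReg_reg, if_neg hr.ne, hr₁ r hr]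
  | fold n e ihn ihe =>
    intro Γ w s B hΓ hB
    obtain ⟨hBn, hN, hBe⟩ := hB
    obtain ⟨t₁, s₁, h₁, ht₁, hm₁, hv₁, hr₁⟩ := ihn Γ w s B hΓ hBn
    set env := Γ.map s.reg with henv
    set N := n.eval s.input env with hNdef
    let I : ℕ → State → Prop := fun j u => u.mem = s.mem ∧ (∀ r < w, u.reg r = s.reg r) ∧
      u.reg w = N ∧ u.reg (w + 1) = j ∧ u.reg (w + 2) = (Term.fold (.const j) e).eval s.input env
    obtain ⟨t₂, s₂, h₂, ht₂, hm₂, hr₂, -, -, hv₂⟩ := Prog.Exec.of_count (a := w + 1) (b := w)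
      (p := (.seq (e.compile (Γ ++ [w + 1, w + 2]) (w + 3))
          (.seq (.const (w + 4) 0) (.seq (.add (w + 2) (w + 3) (w + 4))
            (.seq (.const (w + 3) 1) (.add (w + 1) (w + 1) (w + 3)))))))
      (I := I) (N := N) (T := e.time.eval B + 4)
      (fun j u hu => ⟨hu.2.2.2.1, hu.2.2.1⟩) (by
        rintro j hj u ⟨hm, hr, hw, hw1, hw2⟩
        have hmap : (Γ ++ [w + 1, w + 2]).map u.reg =
            env ++ [j, (Term.fold (.const j) e).eval s.input env] := by
          rw [List.map_append, map_reg_congr hΓ hr, List.map_cons, List.map_cons, hw1, hw2,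
            List.map_nil]
        obtain ⟨t, u', h, ht, hm', hv, hr'⟩ := ihe (Γ ++ [w + 1, w + 2]) (w + 3) u B (by
            intro r hr
            rcases List.mem_append.1 hr with hr | hr
            · have := hΓ r hr; omega
            · simp at hr; omega)
          (by rw [hmap, State.input_congr hm]; exact hBe j hj)
        rw [hmap, State.input_congr hm] at hv
        refine ⟨_, _, .seq h (.seq (.const _ _ _) (.seq (.add _ _ _ _) (.seq (.const _ _ _)
          (.add _ _ _ _)))), ?_, ?_, ?_, ?_, ?_, ?_⟩
        · omega
        · exact hm'.trans hm
        · intro r hrw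
          simp [State.setReg_reg, show r ≠ w + 1 by omega, show r ≠ w + 2 by omega,
            show r ≠ w + 3 by omega, show r ≠ w + 4 by omega, hr' r (by omega), hr r hrw]
        · simp [State.setReg_reg, hr' w (by omega), hw]
        · simp [State.setReg_reg, hr' (w + 1) (by omega), hw1]
        · simp [State.setReg_reg, hv, Term.eval])
      (s := (s₁.setReg (w + 1) 0).setReg (w + 2) 0) (by
        refine ⟨hm₁, ?_, ?_, ?_, ?_⟩
        · intro r hr
          simp [State.setReg_reg, show r ≠ w + 1 by omega, show r ≠ w + 2 by omega, hr₁ r hr]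
        · simp [State.setReg_reg, hv₁]
        · simp [State.setReg_reg]
        · simp [State.setReg_reg, Term.eval])
    refine ⟨_, _, .seq h₁ (.seq (.const _ _ _) (.seq (.const _ _ _) (.seq h₂
      (.seq (.const _ _ _) (.add _ _ _ _))))), ?_, hm₂, ?_, ?_⟩
    · have : N * (e.time.eval B + 4 + 1) ≤ B * (e.time.eval B + 5) := Nat.mul_le_mul_right _ hN
      simp only [Term.time, Polynomial.eval_add, Polynomial.eval_mul, Polynomial.eval_X,
        Polynomial.eval_ofNat]
      omega
    · simp only [State.setReg_reg, if_true]
      simp [hv₂, Term.eval, hNdef]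
    · intro r hr
      simp [State.setReg_reg, hr.ne, show r ≠ w + 3 by omega, hr₂ r hr]

/-! ### Commands and their compilation. -/

/-- Commands that emit pairs of numbers into two output lists. -/
inductive Cmd : Type
  | emit (b : Bool) (e f : Term) : Cmd
  /-- the value of a term becomes the last variable of a command -/
  | bind (e : Term) (c : Cmd) : Cmd
  /-- for `j < n` run a command with `j` as its last variable -/
  | loop (n : Term) (c : Cmd) : Cmd
  | seq (c d : Cmd) : Cmd

/-- The pairs that are emitted into the list `b`. -/
def Cmd.out (inp : Bool → ℕ → ℕ) (b : Bool) : Cmd → List ℕ → List (ℕ × ℕ)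
  | .emit b' e f, env => if b' = b then [(e.eval inp env, f.eval inp env)] else []
  | .bind e c, env => c.out inp b (env ++ [e.eval inp env])
  | .loop n c, env => (List.range (n.eval inp env)).flatMap fun j => c.out inp b (env ++ [j])
  | .seq c d, env => c.out inp b env ++ d.out inp b env

/-- All loops that occur in a command run at most `B` times. -/
def Cmd.Bdd (inp : Bool → ℕ → ℕ) (B : ℕ) : Cmd → List ℕ → Prop
  | .emit _ e f, env => e.Bdd inp B env ∧ f.Bdd inp B env
  | .bind e c, env => e.Bdd inp B env ∧ c.Bdd inp B (env ++ [e.eval inp env])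
  | .loop n c, env => n.Bdd inp B env ∧ n.eval inp env ≤ B ∧
      ∀ j < n.eval inp env, c.Bdd inp B (env ++ [j])
  | .seq c d, env => c.Bdd inp B env ∧ d.Bdd inp B env

/-- An upper bound on the running time, as a polynomial in the bound on the loops. -/
noncomputable def Cmd.time : Cmd → Polynomial ℕ
  | .emit _ e f => e.time + f.time + 8
  | .bind e c => e.time + c.time
  | .loop n c => n.time + 2 + Polynomial.X * (c.time + 3)
  | .seq c d => c.time + d.time

/-- The list `b` is kept in the array `2 + b`, from cell `2` on, and its length in register `b`. -/
def Cmd.compile : Cmd → List ℕ → ℕ → Prog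
  | .emit b e f, Γ, w =>
    .seq (e.compile Γ w) (.seq (f.compile Γ (w + 1))
      (.seq (.add (w + 2) b.toNat b.toNat) (.seq (.const (w + 3) 2)
        (.seq (.add (w + 2) (w + 2) (w + 3)) (.seq (.store (2 + b.toNat) (w + 2) w)
          (.seq (.const (w + 3) 1) (.seq (.add (w + 2) (w + 2) (w + 3))
            (.seq (.store (2 + b.toNat) (w + 2) (w + 1))
              (.add b.toNat b.toNat (w + 3))))))))))
  | .bind e c, Γ, w => .seq (e.compile Γ w) (c.compile (Γ ++ [w]) (w + 1))
  | .loop n c, Γ, w =>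
    .seq (n.compile Γ w) (.seq (.const (w + 1) 0)
      (.whileLt (w + 1) w (.seq (c.compile (Γ ++ [w + 1]) (w + 2))
        (.seq (.const (w + 2) 1) (.add (w + 1) (w + 1) (w + 2))))))
  | .seq c d, Γ, w => .seq (c.compile Γ w) (d.compile Γ w)

/-- The list `l` is stored as the output `b` of the state `s`. -/
def State.Output (s : State) (b : Bool) (l : List (ℕ × ℕ)) : Prop :=
  s.reg b.toNat = l.length ∧ ∀ (i : ℕ) (hi : i < l.length),
    s.mem (2 + b.toNat) (2 + 2 * i) = l[i].1 ∧ s.mem (2 + b.toNat) (3 + 2 * i) = l[i].2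

theorem State.Output.congr {s s' : State} {b : Bool} {l : List (ℕ × ℕ)} (h : s.Output b l)
    (hr : s'.reg b.toNat = s.reg b.toNat)
    (hm : ∀ i, s'.mem (2 + b.toNat) i = s.mem (2 + b.toNat) i) : s'.Output b l := by
  refine ⟨hr.trans h.1, fun i hi => ?_⟩
  rw [hm, hm]
  exact h.2 i hi

theorem map_reg_congr_of_two_le {s s' : State} {Γ : List ℕ} {w : ℕ} (hΓ : ∀ r ∈ Γ, 2 ≤ r ∧ r < w)
    (h : ∀ r, 2 ≤ r → r < w → s'.reg r = s.reg r) : Γ.map s'.reg = Γ.map s.reg :=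
  List.map_congr_left fun r hr => h r (hΓ r hr).1 (hΓ r hr).2

/-- Output goes to the arrays 2 and 3 only, so the inputs survive although the memory changes.
Registers 0 and 1 hold the output lengths, whence `2 ≤ w`. The lists `l` of pairs emitted earlier
are arbitrary, so that sequences and loops can be composed. -/
theorem Cmd.exec_compile (c : Cmd) : ∀ (Γ : List ℕ) (w : ℕ) (s : State) (B : ℕ)
    (l : Bool → List (ℕ × ℕ)), 2 ≤ w → (∀ r ∈ Γ, 2 ≤ r ∧ r < w) →
    c.Bdd s.input B (Γ.map s.reg) → (∀ b, s.Output b (l b)) →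
    ∃ t s', (c.compile Γ w).Exec s t s' ∧ t ≤ c.time.eval B ∧ s'.input = s.input ∧
      (∀ b, s'.Output b (l b ++ c.out s.input b (Γ.map s.reg))) ∧
      ∀ r, 2 ≤ r → r < w → s'.reg r = s.reg r := by
  induction c with
  | emit b e f =>
    intro Γ w s B l hw hΓ hB hl
    have hΓ' : ∀ r ∈ Γ, r < w := fun r hr => (hΓ r hr).2
    obtain ⟨t₁, s₁, h₁, ht₁, hm₁, hv₁, hr₁⟩ := e.exec_compile Γ w s B hΓ' hB.1
    have hΓ₁ := map_reg_congr hΓ' hr₁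
    have hi₁ := State.input_congr hm₁
    obtain ⟨t₂, s₂, h₂, ht₂, hm₂, hv₂, hr₂⟩ := f.exec_compile Γ (w + 1) s₁ B
      (fun r hr => (hΓ' r hr).trans (Nat.lt_succ_self _)) (by rw [hΓ₁, hi₁]; exact hB.2)
    rw [hΓ₁, hi₁] at hv₂
    have hb : ∀ b : Bool, b.toNat < 2 := Bool.toNat_lt
    have hc : ∀ b : Bool, s₂.reg b.toNat = (l b).length := fun b => by
      have := hb b
      rw [hr₂ _ (by omega), hr₁ _ (by omega), (hl b).1]
    have hbw := hb b
    refine ⟨_, _, .seq h₁ (.seq h₂ (.seq (.add _ _ _ _) (.seq (.const _ _ _) (.seq (.add _ _ _ _)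
      (.seq (.store _ _ _ _) (.seq (.const _ _ _) (.seq (.add _ _ _ _) (.seq (.store _ _ _ _)
        (.add _ _ _ _))))))))), ?_, ?_, ?_, ?_⟩
    · simp only [Cmd.time, Polynomial.eval_add, Polynomial.eval_ofNat]; omega
    · funext b' i
      have h3 : b'.toNat ≠ 2 + b.toNat := by have := hb b'; omega
      simp [State.input, State.setReg_mem, State.setMem_mem, h3, hm₂, hm₁]
    · intro b'
      rcases eq_or_ne b b' with rfl | hne
      · refine ⟨?_, ?_⟩
        · simp [State.setReg_reg, State.setMem_reg, hc, Cmd.out, show b.toNat ≠ w + 2 by omega,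
            show b.toNat ≠ w + 3 by omega]
        · intro i hi
          simp only [Cmd.out, if_true, List.length_append, List.length_singleton] at hi
          rcases Nat.lt_succ_iff_lt_or_eq.1 hi with hi' | hi'
          · have := (hl b).2 i hi'
            simp only [Cmd.out, if_true, List.getElem_append_left hi']
            rw [← this.1, ← this.2]
            constructor <;>
            simp [State.setReg_reg, State.setMem_reg, State.setReg_mem, State.setMem_mem, hc,
              show b.toNat ≠ w + 2 by omega, show b.toNat ≠ w + 3 by omega, hm₂, hm₁] <;>
            split_ifs <;> omega
          · subst hi'
            constructor <;>
            simp [State.setReg_reg, State.setMem_reg, State.setReg_mem, State.setMem_mem, hc,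
              show b.toNat ≠ w + 2 by omega, show b.toNat ≠ w + 3 by omega, Cmd.out, hv₂, hv₁,
              hr₂ w (by omega), Nat.two_mul, Nat.add_comm, Nat.add_left_comm]
      · have hne' : b'.toNat ≠ b.toNat := by
          cases b <;> cases b' <;> simp_all
        have hb' := hb b'
        have : (Cmd.emit b e f).out s.input b' (Γ.map s.reg) = [] := by simp [Cmd.out, hne]
        rw [this, List.append_nil]
        refine (hl b').congr ?_ ?_
        · simp [State.setReg_reg, State.setMem_reg, hne', show b'.toNat ≠ w + 2 by omega,
            show b'.toNat ≠ w + 3 by omega, hc, (hl b').1]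
        · intro i
          simp [State.setReg_mem, State.setMem_mem, hne', hm₂, hm₁]
    · intro r hr2 hrw
      simp [State.setReg_reg, State.setMem_reg, show r ≠ b.toNat by omega,
        show r ≠ w + 2 by omega, show r ≠ w + 3 by omega, hr₂ r (by omega), hr₁ r hrw]
  | bind e c ih =>
    intro Γ w s B l hw hΓ hB hl
    have hΓ' : ∀ r ∈ Γ, r < w := fun r hr => (hΓ r hr).2
    obtain ⟨t₁, s₁, h₁, ht₁, hm₁, hv₁, hr₁⟩ := e.exec_compile Γ w s B hΓ' hB.1
    have hmap : (Γ ++ [w]).map s₁.reg = Γ.map s.reg ++ [e.eval s.input (Γ.map s.reg)] := by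
      rw [List.map_append, map_reg_congr hΓ' hr₁, List.map_singleton, hv₁]
    have hi₁ := State.input_congr hm₁
    obtain ⟨t₂, s₂, h₂, ht₂, hm₂, hl₂, hr₂⟩ := ih (Γ ++ [w]) (w + 1) s₁ B l (by omega) (by
        intro r hr
        rcases List.mem_append.1 hr with hr | hr
        · have := hΓ r hr; omega
        · simp at hr; omega)
      (by rw [hmap, hi₁]; exact hB.2)
      (fun b => (hl b).congr (hr₁ _ (by have := Bool.toNat_lt b; omega)) (by simp [hm₁]))
    refine ⟨_, _, .seq h₁ h₂, ?_, hm₂.trans hi₁, ?_, ?_⟩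
    · simp only [Cmd.time, Polynomial.eval_add]; omega
    · intro b
      have := hl₂ b
      rwa [hmap, hi₁] at this
    · intro r hr hrw
      rw [hr₂ r hr (by omega), hr₁ r hrw]
  | loop n c ih =>
    intro Γ w s B l hw hΓ hB hl
    obtain ⟨hBn, hN, hBe⟩ := hB
    have hΓ' : ∀ r ∈ Γ, r < w := fun r hr => (hΓ r hr).2
    obtain ⟨t₁, s₁, h₁, ht₁, hm₁, hv₁, hr₁⟩ := n.exec_compile Γ w s B hΓ' hBn
    set env := Γ.map s.reg with henv
    set N := n.eval s.input env with hNdef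
    let I : ℕ → State → Prop := fun j u => u.input = s.input ∧
      (∀ r, 2 ≤ r → r < w → u.reg r = s.reg r) ∧ u.reg w = N ∧ u.reg (w + 1) = j ∧
      ∀ b, u.Output b (l b ++ (List.range j).flatMap fun i => c.out s.input b (env ++ [i]))
    obtain ⟨t₂, s₂, h₂, ht₂, hm₂, hr₂, -, -, hv₂⟩ := Prog.Exec.of_count (a := w + 1) (b := w)
      (p := (.seq (c.compile (Γ ++ [w + 1]) (w + 2))
        (.seq (.const (w + 2) 1) (.add (w + 1) (w + 1) (w + 2)))))
      (I := I) (N := N) (T := c.time.eval B + 2)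
      (fun j u hu => ⟨hu.2.2.2.1, hu.2.2.1⟩) (by
        rintro j hj u ⟨hm, hr, hw0, hw1, hw2⟩
        have hmap : (Γ ++ [w + 1]).map u.reg = env ++ [j] := by
          rw [List.map_append, map_reg_congr_of_two_le hΓ hr, List.map_singleton, hw1]
        obtain ⟨t, u', h, ht, hm', hv, hr'⟩ := ih (Γ ++ [w + 1]) (w + 2) u B _ (by omega) (by
            intro r hr
            rcases List.mem_append.1 hr with hr | hr
            · have := hΓ r hr; omega
            · simp at hr; omega)
          (by rw [hmap, hm]; exact hBe j hj) hw2
        rw [hmap, hm] at hv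
        refine ⟨_, _, .seq h (.seq (.const _ _ _) (.add _ _ _ _)), ?_, ?_, ?_, ?_, ?_, ?_⟩
        · omega
        · exact hm'.trans hm
        · intro r hr2 hrw
          simp [State.setReg_reg, show r ≠ w + 1 by omega, show r ≠ w + 2 by omega,
            hr' r hr2 (by omega), hr r hr2 hrw]
        · simp [State.setReg_reg, hr' w (by omega), hw0]
        · simp [State.setReg_reg, hr' (w + 1) (by omega), hw1]
        · intro b
          have hb := Bool.toNat_lt b
          rw [List.range_succ, List.flatMap_append, ← List.append_assoc, List.flatMap_singleton]
          refine (hv b).congr ?_ ?_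
          · simp [State.setReg_reg, show b.toNat ≠ w + 1 by omega, show b.toNat ≠ w + 2 by omega]
          · intro i; rfl)
      (s := s₁.setReg (w + 1) 0) (by
        refine ⟨State.input_congr hm₁, ?_, ?_, ?_, ?_⟩
        · intro r hr2 hr
          simp [State.setReg_reg, show r ≠ w + 1 by omega, hr₁ r hr]
        · simp [State.setReg_reg, hv₁]
        · simp [State.setReg_reg]
        · intro b
          have hb := Bool.toNat_lt b
          rw [List.range_zero, List.flatMap_nil, List.append_nil]
          refine (hl b).congr ?_ ?_
          · simp [State.setReg_reg, show b.toNat ≠ w + 1 by omega, hr₁ b.toNat (by omega)]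
          · simp [State.setReg_mem, hm₁])
    refine ⟨_, _, .seq h₁ (.seq (.const _ _ _) h₂), ?_, hm₂, hv₂, hr₂⟩
    have : N * (c.time.eval B + 2 + 1) ≤ B * (c.time.eval B + 3) := Nat.mul_le_mul_right _ hN
    simp only [Cmd.time, Polynomial.eval_add, Polynomial.eval_mul, Polynomial.eval_X,
      Polynomial.eval_ofNat]
    omega
  | seq c d ihc ihd =>
    intro Γ w s B l hw hΓ hB hl
    obtain ⟨t₁, s₁, h₁, ht₁, hm₁, hl₁, hr₁⟩ := ihc Γ w s B l hw hΓ hB.1 hl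
    have hΓ₁ := map_reg_congr_of_two_le hΓ hr₁
    obtain ⟨t₂, s₂, h₂, ht₂, hm₂, hl₂, hr₂⟩ := ihd Γ w s₁ B _ hw hΓ
      (by rw [hΓ₁, hm₁]; exact hB.2) hl₁
    refine ⟨_, _, .seq h₁ h₂, ?_, hm₂.trans hm₁, ?_, ?_⟩
    · simp only [Cmd.time, Polynomial.eval_add]; omega
    · intro b
      have := hl₂ b
      rwa [hΓ₁, hm₁, List.append_assoc] at this
    · intro r hr hrw
      rw [hr₂ r hr hrw, hr₁ r hr hrw]

theorem State.Output.holds {s : State} {b : Bool} {l : List (ℕ × ℕ)} (h : s.Output b l) {n : ℕ}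
    (h0 : s.mem (2 + b.toNat) 0 = n) (h1 : s.mem (2 + b.toNat) 1 = l.length) :
    s.Holds (2 + b.toNat) (n :: l.length :: l.flatMap fun e => [e.1, e.2]) := by
  have key : ∀ (l : List (ℕ × ℕ)) (i : ℕ) (hi : i < (l.flatMap fun e => [e.1, e.2]).length)
      (g : ℕ → ℕ), (∀ (i : ℕ) (hi : i < l.length), g (2 * i) = l[i].1 ∧ g (2 * i + 1) = l[i].2) →
      g i = (l.flatMap fun e => [e.1, e.2])[i] := by
    intro l
    induction l with
    | nil => intro i hi; simp at hi
    | cons e l ih =>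
      intro i hi g hg
      match i with
      | 0 => exact (hg 0 (by simp)).1
      | 1 => exact (hg 0 (by simp)).2
      | i + 2 =>
        exact ih i (by simpa using hi) (fun i => g (i + 2)) fun i hi =>
          hg (i + 1) (by simpa using hi)
  intro i hi
  match i with
  | 0 => exact h0
  | 1 => exact h1
  | i + 2 =>
    refine key l i (by simpa using hi) (fun i => s.mem (2 + b.toNat) (i + 2)) fun i hi => ?_
    have := h.2 i hi
    rw [show 2 + 2 * i = 2 * i + 2 by omega, show 3 + 2 * i = 2 * i + 1 + 2 by omega] at this
    exact this

/-- The inputs of the initial state. -/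
def inputs (v w : List ℕ) (b : Bool) (i : ℕ) : ℕ := (if b then w else v).getD i 0

theorem Cmd.exists_prog (c : Cmd) (e : Bool → Term) :
    ∃ (P : Prog) (p : Polynomial ℕ), ∀ (v w : List ℕ) (B : ℕ),
      c.Bdd (inputs v w) B [] → (∀ b, (e b).Bdd (inputs v w) B []) →
      ∃ (t : ℕ) (s : State), P.Exec (State.init v w) t s ∧ t ≤ p.eval B ∧
        ∀ b, s.Holds (2 + b.toNat) ((e b).eval (inputs v w) [] ::
          (c.out (inputs v w) b []).length ::
            (c.out (inputs v w) b []).flatMap fun e => [e.1, e.2]) := by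
  -- The two header cells are written last, when registers 0 and 1 contain the final numbers of
  -- pairs. The size terms are compiled from register 2 on and leave these counters alone.
  refine ⟨.seq (c.compile [] 2) (.seq
    (.seq ((e false).compile [] 2) (.seq (.const 3 0) (.seq (.store 2 3 2)
      (.seq (.const 3 1) (.store 2 3 0)))))
    (.seq ((e true).compile [] 2) (.seq (.const 3 0) (.seq (.store 3 3 2)
      (.seq (.const 3 1) (.store 3 3 1)))))),
    c.time + (e false).time + (e true).time + 8, ?_⟩
  intro v w B hc he
  have hinp : (State.init v w).input = inputs v w := by
    funext b i
    cases b <;> simp [State.input, State.init, inputs]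
  obtain ⟨t₁, s₁, h₁, ht₁, hi₁, hl₁, -⟩ := c.exec_compile [] 2 (State.init v w) B (fun _ => [])
    le_rfl (by simp) (by rw [hinp]; exact hc) (by intro b; simp [State.Output, State.init])
  rw [hinp] at hi₁
  simp only [hinp, List.nil_append, List.map_nil] at hl₁
  obtain ⟨t₂, s₂, h₂, ht₂, hm₂, hv₂, hr₂⟩ := (e false).exec_compile [] 2 s₁ B (by simp)
    (by rw [hi₁]; exact he false)
  rw [hi₁] at hv₂
  obtain ⟨s₃, hs₃⟩ : ∃ s₃, s₃ = (((s₂.setReg 3 0).setMem 2 0 (s₂.reg 2)).setReg 3 1).setMem 2 1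
    (s₂.reg 0) := ⟨_, rfl⟩
  have hi₃ : s₃.input = inputs v w := by
    rw [← hi₁]
    funext b i
    have := Bool.toNat_lt b
    simp [hs₃, State.input, State.setReg_mem, State.setMem_mem, show b.toNat ≠ 2 by omega, hm₂]
  obtain ⟨t₄, s₄, h₄, ht₄, hm₄, hv₄, hr₄⟩ := (e true).exec_compile [] 2 s₃ B (by simp)
    (by rw [hi₃]; exact he true)
  rw [hi₃] at hv₄
  have h₃ : (Prog.seq ((e false).compile [] 2) (.seq (.const 3 0) (.seq (.store 2 3 2)
      (.seq (.const 3 1) (.store 2 3 0))))).Exec s₁ (t₂ + (1 + (1 + (1 + 1)))) s₃ := by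
    rw [hs₃]
    exact .seq h₂ (.seq (.const _ _ _) (.seq (.store _ _ _ _) (.seq (.const _ _ _)
      (.store _ _ _ _))))
  refine ⟨_, _, .seq h₁ (.seq h₃ (.seq h₄ (.seq (.const _ _ _) (.seq (.store _ _ _ _)
    (.seq (.const _ _ _) (.store _ _ _ _)))))), ?_, ?_⟩
  · simp only [Polynomial.eval_add, Polynomial.eval_ofNat]; omega
  · intro b
    have hreg : ∀ b : Bool, s₄.reg b.toNat = s₁.reg b.toNat := by
      intro b
      have := Bool.toNat_lt b
      rw [hr₄ _ this, hs₃]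
      simp [State.setReg_reg, State.setMem_reg, show b.toNat ≠ 3 by omega, hr₂ _ this]
    have h0 := hreg false
    have h1 := hreg true
    have k0 := (hl₁ false).1
    have k1 := (hl₁ true).1
    have r0 := hr₂ 0 (by omega)
    simp only [Bool.toNat_false, Bool.toNat_true] at h0 h1 k0 k1
    apply State.Output.holds
    · refine ⟨?_, ?_⟩
      · have := Bool.toNat_lt b
        simp [State.setReg_reg, State.setMem_reg, show b.toNat ≠ 3 by omega, hreg, (hl₁ b).1]
      · intro i hi
        have := (hl₁ b).2 i hi
        rw [← this.1, ← this.2]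
        simp [State.setReg_reg, State.setMem_reg, State.setReg_mem, State.setMem_mem, hm₄, hs₃, hm₂,
          show 2 + 2 * i ≠ 1 by omega, show 3 + 2 * i ≠ 1 by omega]
    · cases b <;>
      simp [State.setReg_reg, State.setMem_reg, State.setReg_mem, State.setMem_mem, hm₄, hs₃, hv₂,
        hv₄]
    · cases b <;>
      simp [State.setReg_reg, State.setMem_reg, State.setReg_mem, State.setMem_mem, hm₄, hs₃, h1,
        k0, k1, r0]

end RAM

/-! ### Binary constraint satisfaction as a homomorphism problem for ordered bipartite graphs -/

theorem encodesGraph_of_list {n : ℕ} {G : SimpleGraph (Fin n)} {l : List (ℕ × ℕ)}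
    (hl : ∀ e ∈ l, e.1 < n ∧ e.2 < n)
    (hG : ∀ u v : Fin n, G.Adj u v ↔ ((u : ℕ), (v : ℕ)) ∈ l ∨ ((v : ℕ), (u : ℕ)) ∈ l) :
    EncodesGraph G (n :: l.length :: l.flatMap fun e => [e.1, e.2]) := by
  have : ∃ l' : List (Fin n × Fin n), l'.map (fun e => ((e.1 : ℕ), (e.2 : ℕ))) = l := by
    clear hG
    induction l with
    | nil => exact ⟨[], rfl⟩
    | cons e l ih =>
      obtain ⟨l', hl'⟩ := ih fun e he => hl e (List.mem_cons_of_mem _ he)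
      have he := hl e List.mem_cons_self
      exact ⟨(⟨e.1, he.1⟩, ⟨e.2, he.2⟩) :: l', by simp [hl']⟩
  obtain ⟨l', rfl⟩ := this
  refine ⟨l', fun u v => ?_, ?_⟩
  · rw [hG]
    simp [Fin.val_inj]
  · simp [List.flatMap_map]

/-- Strict growth from the left gives `p ≤ g p`; counting the remaining steps up to `S` gives `g p +
(S - p) ≤ g S ≤ S`. -/
theorem eq_self_of_lt_succ {g : ℕ → ℕ} {S : ℕ} (hg : ∀ p < S, g p < g (p + 1)) (hS : g S ≤ S) :
    ∀ p ≤ S, g p = p := by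
  have h1 : ∀ p ≤ S, p ≤ g p := by
    intro p
    induction p with
    | zero => intro _; exact Nat.zero_le _
    | succ p ih => intro hp; have := ih (by omega); have := hg p (by omega); omega
  have h2 : ∀ d p, p + d = S → g p + d ≤ g S := by
    intro d
    induction d with
    | zero => rintro p rfl; simp
    | succ d ih => intro p hp; have := ih (p + 1) (by omega); have := hg p (by omega); omega
  intro p hp
  have := h1 p hp
  have := h2 (S - p) p (by omega)
  omega

/-- A binary constraint satisfaction problem with the variables `0, …, S` and the values
`0, …, Z - 1`: `C p q` says that there is a constraint on `p` and `q`, and `A p a q b` that it allows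
the values `a` and `b`. Constraints join an even to an odd variable that is not next to it. -/
structure IsParityConstraint (S Z : ℕ) (C : ℕ → ℕ → Prop) (A : ℕ → ℕ → ℕ → ℕ → Prop) : Prop where
  scope : ∀ {p q}, C p q → p ≤ S ∧ q ≤ S ∧ p % 2 = 0 ∧ q % 2 = 1 ∧ q ≠ p + 1 ∧ p ≠ q + 1
  allowed : ∀ {p a q b}, A p a q b → C p q ∧ a < Z ∧ b < Z

/-- The path on the variables, together with the constrained pairs. -/
def constraintEdge (S : ℕ) (C : ℕ → ℕ → Prop) (u v : ℕ) : Prop :=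
  (u < S ∧ v = u + 1) ∨ C u v

/-- Complete bipartite graphs between consecutive blocks, together with the allowed pairs. -/
def valueEdge (S Z : ℕ) (A : ℕ → ℕ → ℕ → ℕ → Prop) (u v : ℕ) : Prop :=
  ∃ p a q b, ((p < S ∧ q = p + 1 ∧ a < Z ∧ b < Z) ∨ A p a q b) ∧ u = p * Z + a ∧ v = q * Z + b

theorem Nat.mul_add_div_eq {p Z a : ℕ} (ha : a < Z) : (p * Z + a) / Z = p := by
  rw [Nat.mul_comm, Nat.mul_add_div (by omega), Nat.div_eq_of_lt ha, Nat.add_zero]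

theorem Nat.mul_add_mod_eq {p Z a : ℕ} (ha : a < Z) : (p * Z + a) % Z = a := by
  rw [Nat.mul_comm, Nat.mul_add_mod, Nat.mod_eq_of_lt ha]

namespace IsParityConstraint

variable {S Z : ℕ} {C : ℕ → ℕ → Prop} {A : ℕ → ℕ → ℕ → ℕ → Prop}

theorem constraintEdge_parity (h : IsParityConstraint S Z C A) {u v : ℕ}
    (huv : constraintEdge S C u v) : u ≤ S ∧ v ≤ S ∧ u % 2 ≠ v % 2 := by
  rcases huv with ⟨h1, rfl⟩ | huv
  · omega
  · have := h.scope huv; omega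

/-- Block number and place in the block are quotient and remainder modulo `Z`, so an edge determines
the data it comes from. -/
theorem valueEdge_iff (h : IsParityConstraint S Z C A) {p a q b : ℕ} (ha : a < Z) (hb : b < Z) :
    valueEdge S Z A (p * Z + a) (q * Z + b) ↔ (p < S ∧ q = p + 1) ∨ A p a q b := by
  constructor
  · rintro ⟨p', a', q', b', hE, hu, hv⟩
    have hab : a' < Z ∧ b' < Z := by
      rcases hE with hE | hE
      · exact hE.2.2
      · exact (h.allowed hE).2
    have h1 := congrArg (· / Z) hu
    have h2 := congrArg (· % Z) hu
    have h3 := congrArg (· / Z) hv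
    have h4 := congrArg (· % Z) hv
    simp only [Nat.mul_add_div_eq ha, Nat.mul_add_div_eq hb, Nat.mul_add_div_eq hab.1,
      Nat.mul_add_div_eq hab.2, Nat.mul_add_mod_eq ha, Nat.mul_add_mod_eq hb,
      Nat.mul_add_mod_eq hab.1, Nat.mul_add_mod_eq hab.2] at h1 h2 h3 h4
    subst h1 h2 h3 h4
    tauto
  · rintro (hE | hE)
    · exact ⟨p, a, q, b, .inl ⟨hE.1, hE.2, ha, hb⟩, rfl, rfl⟩
    · exact ⟨p, a, q, b, .inr hE, rfl, rfl⟩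

theorem valueEdge_parity (h : IsParityConstraint S Z C A) {u v : ℕ}
    (huv : valueEdge S Z A u v) :
    u < (S + 1) * Z ∧ v < (S + 1) * Z ∧ (u / Z) % 2 ≠ (v / Z) % 2 := by
  obtain ⟨p, a, q, b, hE, rfl, rfl⟩ := huv
  have key : p ≤ S ∧ q ≤ S ∧ p % 2 ≠ q % 2 ∧ a < Z ∧ b < Z := by
    rcases hE with hE | hE
    · omega
    · have := h.allowed hE
      have := h.scope this.1
      omega
  obtain ⟨hp, hq, hpq, ha, hb⟩ := key
  rw [Nat.mul_add_div_eq ha, Nat.mul_add_div_eq hb]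
  have h1 := Nat.mul_le_mul_right Z hp
  have h2 := Nat.mul_le_mul_right Z hq
  rw [Nat.add_mul]
  omega

/-- The core of the reduction: monotonicity and parity along the path force each vertex into its own
block, and what remains of the homomorphism is an assignment. -/
theorem orderedHom_iff (h : IsParityConstraint S Z C A) {G : SimpleGraph (Fin (S + 1))}
    {H : SimpleGraph (Fin ((S + 1) * Z))}
    (hG : ∀ u v, G.Adj u v ↔ constraintEdge S C u v ∨ constraintEdge S C v u)
    (hH : ∀ u v, H.Adj u v ↔ valueEdge S Z A u v ∨ valueEdge S Z A v u) :
    OrderedHom G H ↔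
      ∃ φ : ℕ → ℕ, (∀ p, φ p < Z) ∧ ∀ p q, C p q → A p (φ p) q (φ q) := by
  constructor
  · rintro ⟨f, hf⟩
    let g : ℕ → ℕ := fun p => if hp : p < S + 1 then (f ⟨p, hp⟩ : ℕ) else 0
    have hgf : ∀ u : Fin (S + 1), (f u : ℕ) = g u := fun u => by simp only [g, dif_pos u.2]
    have hZ : 0 < Z := by
      have := (f 0).2
      by_contra h0
      have : Z = 0 := by omega
      subst this
      simp at *
    have hadj : ∀ p q, p ≤ S → q ≤ S → constraintEdge S C p q →
        valueEdge S Z A (g p) (g q) ∨ valueEdge S Z A (g q) (g p) := by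
      intro p q hp hq hE
      have : G.Adj ⟨p, by omega⟩ ⟨q, by omega⟩ := (hG _ _).2 (.inl hE)
      have := (hH _ _).1 (f.map_adj this)
      rwa [hgf, hgf] at this
    have hblock : ∀ p ≤ S, g p / Z = p := by
      apply eq_self_of_lt_succ (g := fun p => g p / Z)
      · intro p hp
        have h1 : g p ≤ g (p + 1) := by
          have : (⟨p, by omega⟩ : Fin (S + 1)) ≤ ⟨p + 1, by omega⟩ := by
            simp [Fin.le_def]
          have := hf this
          rw [Fin.le_def, hgf, hgf] at this
          exact this
        have h2 := Nat.div_le_div_right (c := Z) h1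
        -- Monotonicity gives only a weak inequality of block numbers; the parity of the blocks
        -- joined by an edge makes it strict.
        have h3 : g p / Z ≠ g (p + 1) / Z := by
          rcases hadj p (p + 1) hp.le hp (.inl ⟨hp, rfl⟩) with h3 | h3
          · have := (h.valueEdge_parity h3).2.2
            intro h4; rw [h4] at this; exact this rfl
          · have := (h.valueEdge_parity h3).2.2
            intro h4; rw [h4] at this; exact this rfl
        exact lt_of_le_of_ne h2 h3
      · have h1 : g S < (S + 1) * Z := by
          have := (f ⟨S, by omega⟩).2
          rwa [hgf] at this
        have := Nat.div_lt_of_lt_mul (by rwa [Nat.mul_comm] at h1 : g S < Z * (S + 1))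
        change g S / Z ≤ S
        omega
    have hdec : ∀ p ≤ S, g p = p * Z + g p % Z := by
      intro p hp
      have := Nat.div_add_mod (g p) Z
      rw [hblock p hp, Nat.mul_comm] at this
      exact this.symm
    refine ⟨fun p => g p % Z, fun p => Nat.mod_lt _ hZ, fun p q hC => ?_⟩
    have hpq := h.scope hC
    have := hadj p q hpq.1 hpq.2.1 (.inr hC)
    rw [hdec p hpq.1, hdec q hpq.2.1, h.valueEdge_iff (Nat.mod_lt _ hZ) (Nat.mod_lt _ hZ),
      h.valueEdge_iff (Nat.mod_lt _ hZ) (Nat.mod_lt _ hZ)] at this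
    -- Edges between neighbouring blocks are excluded because `p` and `q` are not neighbours, and an
    -- allowed pair in the reverse direction because it would make `q` even.
    rcases this with (h1 | h1) | (h1 | h1)
    · omega
    · exact h1
    · omega
    · have := h.scope (h.allowed h1).1
      omega
  · rintro ⟨φ, hφ, hA⟩
    have hlt : ∀ u : Fin (S + 1), (u : ℕ) * Z + φ u < (S + 1) * Z := fun u => by
      have h1 := Nat.mul_le_mul_right Z (Nat.le_of_lt_succ u.2)
      have := hφ u
      rw [Nat.add_mul]
      omega
    have hedge : ∀ p q, constraintEdge S C p q →
        valueEdge S Z A (p * Z + φ p) (q * Z + φ q) := by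
      intro p q hE
      rw [h.valueEdge_iff (hφ p) (hφ q)]
      exact hE.imp id (hA p q)
    refine ⟨⟨fun u => ⟨u * Z + φ u, hlt u⟩, ?_⟩, ?_⟩
    · intro u v huv
      rw [hH]
      exact ((hG _ _).1 huv).imp (hedge _ _) (hedge _ _)
    · intro u v huv
      rcases huv.eq_or_lt with rfl | huv
      · exact le_rfl
      · change (u : ℕ) * Z + φ u ≤ v * Z + φ v
        -- For `u < v` the whole block of `u` lies before that of `v`, so the values do not matter.
        have h1 := Nat.mul_le_mul_right Z (Fin.lt_def.1 huv)
        rw [Nat.succ_mul] at h1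
        have := hφ u
        omega

theorem exists_graphs (h : IsParityConstraint S Z C A) {lG lH : List (ℕ × ℕ)}
    (hlG : ∀ u v, (u, v) ∈ lG ↔ constraintEdge S C u v)
    (hlH : ∀ u v, (u, v) ∈ lH ↔ valueEdge S Z A u v) :
    ∃ (G : SimpleGraph (Fin (S + 1))) (H : SimpleGraph (Fin ((S + 1) * Z))),
      EncodesGraph G ((S + 1) :: lG.length :: lG.flatMap fun e => [e.1, e.2]) ∧
      EncodesGraph H ((S + 1) * Z :: lH.length :: lH.flatMap fun e => [e.1, e.2]) ∧
      G.IsBipartite ∧ H.IsBipartite ∧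
      (OrderedHom G H ↔ ∃ φ : ℕ → ℕ, (∀ p, φ p < Z) ∧ ∀ p q, C p q → A p (φ p) q (φ q)) := by
  let G : SimpleGraph (Fin (S + 1)) :=
    { Adj := fun u v => constraintEdge S C u v ∨ constraintEdge S C v u
      symm := ⟨fun _ _ => Or.symm⟩
      loopless := ⟨fun u hu => (h.constraintEdge_parity (hu.elim id id)).2.2 rfl⟩ }
  let H : SimpleGraph (Fin ((S + 1) * Z)) :=
    { Adj := fun u v => valueEdge S Z A u v ∨ valueEdge S Z A v u
      symm := ⟨fun _ _ => Or.symm⟩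
      loopless := ⟨fun u hu => (h.valueEdge_parity (hu.elim id id)).2.2 rfl⟩ }
  refine ⟨G, H, encodesGraph_of_list ?_ ?_, encodesGraph_of_list ?_ ?_, ?_, ?_,
    h.orderedHom_iff (fun _ _ => Iff.rfl) (fun _ _ => Iff.rfl)⟩
  · rintro ⟨u, v⟩ he
    have := h.constraintEdge_parity ((hlG u v).1 he)
    dsimp only
    omega
  · intro u v
    rw [hlG, hlG]
  · rintro ⟨u, v⟩ he
    have := h.valueEdge_parity ((hlH u v).1 he)
    exact ⟨this.1, this.2.1⟩
  · intro u v
    rw [hlH, hlH]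
  · refine ⟨SimpleGraph.Coloring.mk (fun u => ⟨(u : ℕ) % 2, Nat.mod_lt _ two_pos⟩) ?_⟩
    intro u v huv heq
    have heq := congrArg Fin.val heq
    rcases huv with huv | huv
    · exact (h.constraintEdge_parity huv).2.2 heq
    · exact (h.constraintEdge_parity huv).2.2 heq.symm
  · refine ⟨SimpleGraph.Coloring.mk (fun u => ⟨((u : ℕ) / Z) % 2, Nat.mod_lt _ two_pos⟩) ?_⟩
    intro u v huv heq
    have heq := congrArg Fin.val heq
    rcases huv with huv | huv
    · exact (h.valueEdge_parity huv).2.2 heq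
    · exact (h.valueEdge_parity huv).2.2 heq.symm

end IsParityConstraint

/-! ### The constraint satisfaction problem of a pair of relational structures -/

/-- Two relational structures with the same `k` symbols, with elements numbered from `0`: for each
symbol, its arity, and for each of the two structures the number of tuples and their entries. -/
structure HomData : Type where
  k : ℕ
  m : ℕ
  n : ℕ
  arity : ℕ → ℕ
  cardM : ℕ → ℕ
  cardN : ℕ → ℕ
  entryM : ℕ → ℕ → ℕ → ℕ
  entryN : ℕ → ℕ → ℕ → ℕ

namespace HomData

/-- All numbers in the description are at most `Z`. -/
structure IsBounded (D : HomData) (Z : ℕ) : Prop where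
  pos : 0 < Z
  k_le : D.k ≤ Z
  m_le : D.m ≤ Z
  n_le : D.n ≤ Z
  cardM_le : ∀ j < D.k, D.cardM j ≤ Z
  cardN_le : ∀ j < D.k, D.cardN j ≤ Z
  -- The size of a structure does not count the arity of an empty relation, so no unconditional
  -- bound is available.
  arity_le : ∀ j < D.k, 0 < D.cardM j → D.arity j ≤ Z
  entryM_lt : ∀ j < D.k, ∀ t < D.cardM j, ∀ i < D.arity j, D.entryM j t i < D.m
  entryN_lt : ∀ j < D.k, ∀ t < D.cardN j, ∀ i < D.arity j, D.entryN j t i < D.n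

/-- The position of the variables that belong to tuple `t` of symbol `j`. -/
def base (Z j t : ℕ) : ℕ := (j * Z + t) * Z * 8

/-- The constrained pairs. The variable of the element `x` is `8x`, and the variable of a tuple at
the position `q` is `q + 2`. Both are joined to an own auxiliary variable, which serves to restrict
their values. The variables `q + 8i + 5` stand for the entries of the tuple; they are joined to the
variable of the tuple and to that of the element. -/
def Scope (D : HomData) (Z p q : ℕ) : Prop :=
  (∃ x < D.m, p = x * 8 ∧ q = x * 8 + 3) ∨
    ∃ j < D.k, ∃ t < D.cardM j,
      (p = base Z j t + 2 ∧ q = base Z j t + 7) ∨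
      ∃ i < D.arity j,
        (p = base Z j t + 2 ∧ q = base Z j t + i * 8 + 5) ∨
        (p = D.entryM j t i * 8 ∧ q = base Z j t + i * 8 + 5)

/-- The pairs of values that the constraints allow. -/
def Allowed (D : HomData) (Z p a q b : ℕ) : Prop :=
  (∃ x < D.m, p = x * 8 ∧ q = x * 8 + 3 ∧ a < D.n ∧ b = 0) ∨
    ∃ j < D.k, ∃ t < D.cardM j,
      (p = base Z j t + 2 ∧ q = base Z j t + 7 ∧ a < D.cardN j ∧ b = 0) ∨
      ∃ i < D.arity j,
        (p = base Z j t + 2 ∧ q = base Z j t + i * 8 + 5 ∧ a < D.cardN j ∧ b = D.entryN j a i) ∨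
        (p = D.entryM j t i * 8 ∧ q = base Z j t + i * 8 + 5 ∧ a < D.n ∧ b = a)

theorem base_mod (Z j t : ℕ) : base Z j t % 8 = 0 := by simp [base]

theorem base_add_lt {Z j t i : ℕ} (hj : j < Z) (ht : t < Z) (hi : i < Z) :
    base Z j t + i * 8 + 8 ≤ 8 * Z * Z * Z := by
  unfold base
  have h1 : j * Z + t + 1 ≤ Z * Z := by
    have := Nat.mul_le_mul_right Z (show j + 1 ≤ Z from hj)
    rw [Nat.add_mul] at this
    omega
  have h2 := Nat.mul_le_mul_right Z h1
  rw [Nat.add_mul] at h2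
  have : 8 * Z * Z * Z = Z * Z * Z * 8 := by ring
  omega

/-- After division by 8, the numbers `j`, `t`, `i` can be read off by two divisions by `Z`, as `t`
and `i` are below `Z`. -/
theorem base_add_inj {Z j t i j' t' i' : ℕ} (ht : t < Z) (hi : i < Z) (ht' : t' < Z) (hi' : i' < Z)
    (h : base Z j t + i * 8 = base Z j' t' + i' * 8) : j = j' ∧ t = t' ∧ i = i' := by
  have h0 : (j * Z + t) * Z + i = (j' * Z + t') * Z + i' := by
    unfold base at h; omega
  have h1 := congrArg (· / Z) h0
  have h2 := congrArg (· % Z) h0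
  simp only [Nat.mul_add_div_eq hi, Nat.mul_add_div_eq hi', Nat.mul_add_mod_eq hi,
    Nat.mul_add_mod_eq hi'] at h1 h2
  have h3 := congrArg (· / Z) h1
  have h4 := congrArg (· % Z) h1
  simp only [Nat.mul_add_div_eq ht, Nat.mul_add_div_eq ht', Nat.mul_add_mod_eq ht,
    Nat.mul_add_mod_eq ht'] at h3 h4
  exact ⟨h3, h4, h2⟩

variable {D : HomData} {Z : ℕ}

/-- The residues modulo 8 are 0 and 2 on the even side and 3, 5, 7 on the odd side. The constrained
combinations are 0–3, 2–7, 2–5 and 0–5, none of which differ by 1 modulo 8. The length `8 * Z ^ 3`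
leaves 8 places for every triple of symbol, tuple and entry. -/
theorem IsBounded.isParityConstraint (h : D.IsBounded Z) :
    IsParityConstraint (8 * Z * Z * Z) Z (D.Scope Z) (D.Allowed Z) := by
  -- This makes room for the element variables, which reach only up to about `8 * Z`.
  have hZ : Z ≤ Z * Z * Z := by
    have := h.pos
    nlinarith [Nat.mul_le_mul this this, Nat.mul_le_mul (Nat.mul_le_mul this this) this,
      Nat.mul_le_mul (Nat.mul_le_mul this this) (le_refl Z)]
  have hS : 8 * Z * Z * Z = 8 * (Z * Z * Z) := by ring
  constructor
  · rintro p q (⟨x, hx, rfl, rfl⟩ | ⟨j, hj, t, ht, ⟨rfl, rfl⟩ | ⟨i, hi, ⟨rfl, rfl⟩ | ⟨rfl, rfl⟩⟩⟩)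
    · have := h.m_le
      omega
    · have := base_mod Z j t
      have := base_add_lt (hj.trans_le h.k_le) (ht.trans_le (h.cardM_le j hj)) h.pos
      omega
    · have := base_mod Z j t
      have := base_add_lt (hj.trans_le h.k_le) (ht.trans_le (h.cardM_le j hj))
        (hi.trans_le (h.arity_le j hj (by omega)))
      omega
    · have := base_mod Z j t
      have := base_add_lt (hj.trans_le h.k_le) (ht.trans_le (h.cardM_le j hj))
        (hi.trans_le (h.arity_le j hj (by omega)))
      have := h.entryM_lt j hj t ht i hi
      have := h.m_le
      omega
  · have hn := h.n_le
    have hpos := h.pos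
    rintro p a q b (⟨x, hx, hp, hq, ha, rfl⟩ | ⟨j, hj, t, ht, ⟨hp, hq, ha, rfl⟩ |
      ⟨i, hi, ⟨hp, hq, ha, rfl⟩ | ⟨hp, hq, ha, rfl⟩⟩⟩)
    · exact ⟨.inl ⟨x, hx, hp, hq⟩, by omega, hpos⟩
    · exact ⟨.inr ⟨j, hj, t, ht, .inl ⟨hp, hq⟩⟩, ha.trans_le (h.cardN_le j hj), hpos⟩
    · exact ⟨.inr ⟨j, hj, t, ht, .inr ⟨i, hi, .inl ⟨hp, hq⟩⟩⟩, ha.trans_le (h.cardN_le j hj),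
        (h.entryN_lt j hj a ha i hi).trans_le hn⟩
    · exact ⟨.inr ⟨j, hj, t, ht, .inr ⟨i, hi, .inr ⟨hp, hq⟩⟩⟩, ha.trans_le hn, ha.trans_le hn⟩

/-- `f` maps elements to elements and `τ` maps each tuple to its image. -/
def IsHom (D : HomData) (f : ℕ → ℕ) (τ : ℕ → ℕ → ℕ) : Prop :=
  (∀ x < D.m, f x < D.n) ∧ ∀ j < D.k, ∀ t < D.cardM j, τ j t < D.cardN j ∧
    ∀ i < D.arity j, f (D.entryM j t i) = D.entryN j (τ j t) i

/-- The value of an entry variable is forced twice: by the chosen image tuple and by the chosen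
image of the element. Their agreement is the homomorphism condition. -/
theorem IsBounded.exists_assignment_iff (h : D.IsBounded Z) :
    (∃ φ : ℕ → ℕ, (∀ p, φ p < Z) ∧ ∀ p q, D.Scope Z p q → D.Allowed Z p (φ p) q (φ q)) ↔
      ∃ f τ, D.IsHom f τ := by
  constructor
  · rintro ⟨φ, -, hφ⟩
    refine ⟨fun x => φ (x * 8), fun j t => φ (base Z j t + 2), ?_, ?_⟩
    · intro x hx
      -- The residues of `p` and `q` modulo 8 leave only one kind of allowed pair; here and below
      -- the other cases contradict `base_mod`.
      rcases hφ _ _ (.inl ⟨x, hx, rfl, rfl⟩) with ⟨x', hx', hp, hq, ha, -⟩ | ⟨j', hj', t', ht',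
        ⟨hp, hq, -⟩ | ⟨i', hi', ⟨hp, hq, -⟩ | ⟨hp, hq, -⟩⟩⟩
      · exact ha
      all_goals have := base_mod Z j' t'; omega
    · intro j hj t ht
      have hjt := base_mod Z j t
      have htZ := ht.trans_le (h.cardM_le j hj)
      refine ⟨?_, ?_⟩
      · rcases hφ _ _ (.inr ⟨j, hj, t, ht, .inl ⟨rfl, rfl⟩⟩) with ⟨x', hx', hp, hq, ha, -⟩ |
          ⟨j', hj', t', ht', ⟨hp, hq, ha, -⟩ | ⟨i', hi', ⟨hp, hq, -⟩ | ⟨hp, hq, -⟩⟩⟩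
        · omega
        · obtain ⟨rfl, rfl, -⟩ := base_add_inj htZ h.pos (ht'.trans_le (h.cardM_le j' hj')) h.pos
            (by omega : base Z j t + 0 * 8 = base Z j' t' + 0 * 8)
          exact ha
        all_goals have := base_mod Z j' t'; omega
      · intro i hi
        have hiZ := hi.trans_le (h.arity_le j hj (by omega))
        have h1 : φ (base Z j t + i * 8 + 5) = D.entryN j (φ (base Z j t + 2)) i := by
          rcases hφ _ _ (.inr ⟨j, hj, t, ht, .inr ⟨i, hi, .inl ⟨rfl, rfl⟩⟩⟩) with
            ⟨x', hx', hp, hq, ha, -⟩ |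
            ⟨j', hj', t', ht', ⟨hp, hq, ha, -⟩ | ⟨i', hi', ⟨hp, hq, -, hb⟩ | ⟨hp, hq, -⟩⟩⟩
          · omega
          · have := base_mod Z j' t'; omega
          · obtain ⟨rfl, rfl, rfl⟩ := base_add_inj htZ hiZ (ht'.trans_le (h.cardM_le j' hj'))
              (hi'.trans_le (h.arity_le j' hj' (by omega)))
              (by omega : base Z j t + i * 8 = base Z j' t' + i' * 8)
            exact hb
          · omega
        rcases hφ _ _ (.inr ⟨j, hj, t, ht, .inr ⟨i, hi, .inr ⟨rfl, rfl⟩⟩⟩) with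
          ⟨x', hx', hp, hq, ha, -⟩ |
          ⟨j', hj', t', ht', ⟨hp, hq, ha, -⟩ | ⟨i', hi', ⟨hp, hq, -⟩ | ⟨hp, hq, -, hb⟩⟩⟩
        · omega
        · have := base_mod Z j' t'; omega
        · have := base_mod Z j' t'; omega
        -- This constraint just copies the value, so the tuple and entry that witness it need not be
        -- identified.
        · exact hb.symm.trans h1
  · rintro ⟨f, τ, hf, hτ⟩
    obtain ⟨φ, hφ⟩ : ∃ φ : ℕ → ℕ, φ = fun p =>
      -- The assignment decodes the position. The final remainder modulo `Z` changes no value that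
      -- matters and keeps the values at meaningless positions below `Z`.
      (if p % 8 = 0 then f (p / 8)
        else if p % 8 = 2 then τ (p / 8 / Z / Z) (p / 8 / Z % Z)
        else if p % 8 = 5 then f (D.entryM (p / 8 / Z / Z) (p / 8 / Z % Z) (p / 8 % Z))
        else 0) % Z := ⟨_, rfl⟩
    have hdecode : ∀ j t i r, t < Z → i < Z → r < 8 →
        (base Z j t + i * 8 + r) % 8 = r ∧ (base Z j t + i * 8 + r) / 8 / Z / Z = j ∧
        (base Z j t + i * 8 + r) / 8 / Z % Z = t ∧ (base Z j t + i * 8 + r) / 8 % Z = i := by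
      intro j t i r ht hi hr
      have h1 : (base Z j t + i * 8 + r) / 8 = (j * Z + t) * Z + i := by unfold base; omega
      have h2 := base_mod Z j t
      refine ⟨by omega, ?_, ?_, ?_⟩
      · rw [h1, Nat.mul_add_div_eq hi, Nat.mul_add_div_eq ht]
      · rw [h1, Nat.mul_add_div_eq hi, Nat.mul_add_mod_eq ht]
      · rw [h1, Nat.mul_add_mod_eq hi]
    have h0 : ∀ x, φ (x * 8) = f x % Z := by intro x; simp [hφ]
    have h3 : ∀ x, φ (x * 8 + 3) = 0 := by
      intro x
      have : (x * 8 + 3) % 8 = 3 := by omega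
      simp [hφ, this]
    have h2 : ∀ j t, t < Z → φ (base Z j t + 2) = τ j t % Z := by
      intro j t ht
      have := hdecode j t 0 2 ht h.pos (by omega)
      rw [Nat.zero_mul, Nat.add_zero] at this
      simp [hφ, this.1, this.2.1, this.2.2.1]
    have h7 : ∀ j t, φ (base Z j t + 7) = 0 := by
      intro j t
      have : (base Z j t + 7) % 8 = 7 := by have := base_mod Z j t; omega
      simp [hφ, this]
    have h5 : ∀ j t i, t < Z → i < Z → φ (base Z j t + i * 8 + 5) = f (D.entryM j t i) % Z := by
      intro j t i ht hi
      have := hdecode j t i 5 ht hi (by omega)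
      simp [hφ, this.1, this.2.1, this.2.2.1, this.2.2.2]
    refine ⟨φ, fun p => by rw [hφ]; exact Nat.mod_lt _ h.pos, ?_⟩
    rintro p q (⟨x, hx, rfl, rfl⟩ | ⟨j, hj, t, ht, ⟨rfl, rfl⟩ | ⟨i, hi, ⟨rfl, rfl⟩ | ⟨rfl, rfl⟩⟩⟩)
    · rw [h0, h3, Nat.mod_eq_of_lt ((hf x hx).trans_le h.n_le)]
      exact .inl ⟨x, hx, rfl, rfl, hf x hx, rfl⟩
    · have htZ := ht.trans_le (h.cardM_le j hj)
      have := (hτ j hj t ht).1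
      rw [h2 j t htZ, h7, Nat.mod_eq_of_lt (this.trans_le (h.cardN_le j hj))]
      exact .inr ⟨j, hj, t, ht, .inl ⟨rfl, rfl, this, rfl⟩⟩
    · have htZ := ht.trans_le (h.cardM_le j hj)
      have hiZ := hi.trans_le (h.arity_le j hj (by omega))
      have h8 := (hτ j hj t ht).1
      have h9 := hf _ (h.entryM_lt j hj t ht i hi)
      rw [h2 j t htZ, h5 j t i htZ hiZ, Nat.mod_eq_of_lt (h8.trans_le (h.cardN_le j hj)),
        Nat.mod_eq_of_lt (h9.trans_le h.n_le)]
      exact .inr ⟨j, hj, t, ht, .inr ⟨i, hi, .inl ⟨rfl, rfl, h8, (hτ j hj t ht).2 i hi⟩⟩⟩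
    · have htZ := ht.trans_le (h.cardM_le j hj)
      have hiZ := hi.trans_le (h.arity_le j hj (by omega))
      have h9 := hf _ (h.entryM_lt j hj t ht i hi)
      rw [h0, h5 j t i htZ hiZ, Nat.mod_eq_of_lt (h9.trans_le h.n_le)]
      exact .inr ⟨j, hj, t, ht, .inr ⟨i, hi, .inr ⟨rfl, rfl, h9, rfl⟩⟩⟩

/-! ### From the numerical description back to the structures. -/

/-- `D` describes the structures `M` and `N` with respect to the given numberings. -/
structure Describes {L : FirstOrder.Language} {k : ℕ} (D : HomData)
    (sym : Fin k ≃ Σ l, L.Relations l) {M N : Type*} {m n : ℕ} (vM : M ≃ Fin m) (vN : N ≃ Fin n)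
    (tM : (j : Fin k) → List (Fin (sym j).1 → M)) (tN : (j : Fin k) → List (Fin (sym j).1 → N)) :
    Prop where
  k_eq : D.k = k
  m_eq : D.m = m
  n_eq : D.n = n
  arity_eq : ∀ j : Fin k, D.arity j = (sym j).1
  cardM_eq : ∀ j : Fin k, D.cardM j = (tM j).length
  cardN_eq : ∀ j : Fin k, D.cardN j = (tN j).length
  entryM_eq : ∀ (j : Fin k) (t : ℕ) (ht : t < (tM j).length) (i : Fin (sym j).1),
    D.entryM j t i = vM ((tM j)[t] i)
  entryN_eq : ∀ (j : Fin k) (t : ℕ) (ht : t < (tN j).length) (i : Fin (sym j).1),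
    D.entryN j t i = vN ((tN j)[t] i)

theorem Describes.exists_isHom_iff {L : FirstOrder.Language} [L.IsRelational] {k : ℕ}
    {sym : Fin k ≃ Σ l, L.Relations l} {M N : Type*} [L.Structure M] [L.Structure N] {m n : ℕ}
    {vM : M ≃ Fin m} {vN : N ≃ Fin n}
    {tM : (j : Fin k) → List (Fin (sym j).1 → M)} {tN : (j : Fin k) → List (Fin (sym j).1 → N)}
    (hD : D.Describes sym vM vN tM tN)
    (hM : ∀ j x, x ∈ tM j ↔ FirstOrder.Language.Structure.RelMap (sym j).2 x)
    (hN : ∀ j x, x ∈ tN j ↔ FirstOrder.Language.Structure.RelMap (sym j).2 x) :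
    (∃ f τ, D.IsHom f τ) ↔ Nonempty (L.Hom M N) := by
  constructor
  · rintro ⟨f, τ, hf, hτ⟩
    have hf' : ∀ x : M, f (vM x) < n := fun x => by
      rw [← hD.n_eq]; exact hf _ (by rw [hD.m_eq]; exact (vM x).2)
    refine ⟨⟨fun x => vN.symm ⟨f (vM x), hf' x⟩, ?_, ?_⟩⟩
    · intro l g
      exact isEmptyElim g
    · intro l R x hx
      obtain ⟨j, hj⟩ := sym.surjective ⟨l, R⟩
      -- The symbol is generalized together with its arity, so that the equation `hj` can be
      -- eliminated without casts of tuples.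
      have key : ∀ (S : Σ l, L.Relations l) (hS : sym j = S) (x : Fin S.1 → M),
          FirstOrder.Language.Structure.RelMap S.2 x →
          FirstOrder.Language.Structure.RelMap S.2
            ((fun x => vN.symm ⟨f (vM x), hf' x⟩) ∘ x) := by
        rintro _ rfl x hx
        rw [← hM] at hx
        obtain ⟨t, ht, rfl⟩ := List.getElem_of_mem hx
        obtain ⟨h1, h2⟩ := hτ j (by rw [hD.k_eq]; exact j.2) t (by rwa [hD.cardM_eq])
        rw [hD.cardN_eq] at h1
        rw [← hN]
        convert List.getElem_mem h1
        funext i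
        have h3 := h2 i (by rw [hD.arity_eq]; exact i.2)
        rw [hD.entryM_eq j t ht, hD.entryN_eq j _ h1] at h3
        simp only [Function.comp]
        rw [Equiv.symm_apply_eq]
        exact Fin.ext h3
      exact key ⟨l, R⟩ hj x hx
  · rintro ⟨g⟩
    -- The image of a listed tuple is again listed; choosing its index yields `τ`.
    have himg : ∀ (j : Fin k) (t : Fin (tM j).length),
        ∃ t' : Fin (tN j).length, (tN j)[t'] = g ∘ (tM j)[t] := by
      intro j t
      have h1 := g.map_rel (sym j).2 _ ((hM j _).1 (List.getElem_mem t.2))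
      rw [← hN] at h1
      obtain ⟨t', ht', h2⟩ := List.getElem_of_mem h1
      exact ⟨⟨t', ht'⟩, h2⟩
    choose τ hτ using himg
    refine ⟨fun x => if hx : x < m then vN (g (vM.symm ⟨x, hx⟩)) else 0,
      fun j t => if h : ∃ hj : j < k, t < (tM ⟨j, hj⟩).length then τ ⟨j, h.1⟩ ⟨t, h.2⟩ else 0,
      ?_, ?_⟩
    · intro x hx
      rw [hD.m_eq] at hx
      beta_reduce
      rw [dif_pos hx, hD.n_eq]
      exact (vN _).2
    · intro j hj t ht
      rw [hD.k_eq] at hj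
      have ht' : t < (tM ⟨j, hj⟩).length := by rwa [← hD.cardM_eq ⟨j, hj⟩]
      have hjt : ∃ hj : j < k, t < (tM ⟨j, hj⟩).length := ⟨hj, ht'⟩
      beta_reduce
      rw [dif_pos hjt]
      refine ⟨?_, fun i hi => ?_⟩
      · rw [hD.cardN_eq ⟨j, hj⟩]
        exact (τ ⟨j, hj⟩ ⟨t, ht'⟩).2
      · have hi' : i < (sym ⟨j, hj⟩).1 := by rwa [← hD.arity_eq ⟨j, hj⟩]
        have h1 := hD.entryM_eq ⟨j, hj⟩ t ht' ⟨i, hi'⟩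
        have h2 := hD.entryN_eq ⟨j, hj⟩ _ (τ ⟨j, hj⟩ ⟨t, ht'⟩).2 ⟨i, hi'⟩
        have h3 := congrFun (hτ ⟨j, hj⟩ ⟨t, ht'⟩) ⟨i, hi'⟩
        simp only [Fin.getElem_fin] at h1 h2 h3
        rw [h1, h2, h3, dif_pos (vM _).2]
        simp

end HomData

/-! ### The program -/

namespace RAM

/-- The offset of the section of the `j`-th symbol in an input word, after the first two cells. -/
def sectionOffset (inp : Bool → ℕ → ℕ) (b : Bool) (j : ℕ) : ℕ :=
  Nat.rec (motive := fun _ => ℕ) 0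
    (fun _ o => o + (2 + inp b (o + 2) * inp b (o + 3))) j

theorem sectionOffset_succ (inp : Bool → ℕ → ℕ) (b : Bool) (j : ℕ) :
    sectionOffset inp b (j + 1) = sectionOffset inp b j +
      (2 + inp b (sectionOffset inp b j + 2) * inp b (sectionOffset inp b j + 3)) := rfl

/-- The two structures that are described by the input words. -/
def inputData (inp : Bool → ℕ → ℕ) : HomData where
  k := inp false 0
  m := inp false 1
  n := inp true 1
  arity j := inp false (sectionOffset inp false j + 2)
  cardM j := inp false (sectionOffset inp false j + 3)
  cardN j := inp true (sectionOffset inp true j + 3)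
  entryM j t i := inp false (sectionOffset inp false j + 4 +
    (inp false (sectionOffset inp false j + 2) * t + i))
  -- The arity is taken from the first word; both words list the symbols in the same order, so the
  -- arities agree.
  entryN j t i := inp true (sectionOffset inp true j + 4 +
    (inp false (sectionOffset inp false j + 2) * t + i))

/-- A bound for the numbers in the input. -/
def inputBound (inp : Bool → ℕ → ℕ) : ℕ :=
  sectionOffset inp false (inp false 0) + sectionOffset inp true (inp false 0) +
    inp false 0 + inp false 1 + inp true 1 + 1

theorem rec_add_const (c N : ℕ) :
    Nat.rec (motive := fun _ => ℕ) 0 (fun _ x => x + c) N = c * N := by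
  induction N with
  | zero => rfl
  | succ N ih => rw [Nat.mul_succ, ← ih]

namespace Term

/-- The product `f * e`, where `d` is the number of variables. -/
def mul (d : ℕ) (e f : Term) : Term := .fold e (.add (.var (d + 1)) f)

/-- The offset of a section, where `d` is the number of variables. -/
def offset (d : ℕ) (b : Bool) (e : Term) : Term :=
  .fold e (.add (.var (d + 1)) (.add (.const 2)
    -- The product is a loop over the number of tuples, not over the arity, which may be huge when
    -- the relation is empty.
    (mul (d + 2) (.load b (.add (.var (d + 1)) (.const 3)))
      (.load b (.add (.var (d + 1)) (.const 2))))))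

variable {inp : Bool → ℕ → ℕ} {B : ℕ} {env : List ℕ}

theorem getD_append_length (env : List ℕ) (a x : ℕ) :
    (env ++ [a, x]).getD (env.length + 1) 0 = x := by
  simp

/-- Variables are numbered from the outside and new ones are appended, so a factor keeps its meaning
inside the loop; `hf` says that it ignores the two new variables. -/
theorem eval_mul {e f : Term} {c : ℕ} (hf : ∀ j x, f.eval inp (env ++ [j, x]) = c) :
    (mul env.length e f).eval inp env = c * e.eval inp env := by
  simp only [mul, eval, getD_append_length, hf, rec_add_const]

theorem bdd_mul {e f : Term} (he : e.Bdd inp B env) (heB : e.eval inp env ≤ B)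
    (hf : ∀ j x, f.Bdd inp B (env ++ [j, x])) : (mul env.length e f).Bdd inp B env :=
  ⟨he, heB, fun _ _ => ⟨trivial, hf _ _⟩⟩

theorem getD_append_append_length (env : List ℕ) (a x a' x' : ℕ) :
    ((env ++ [a, x]) ++ [a', x']).getD (env.length + 1) 0 = x := by
  simp

theorem eval_offset (b : Bool) (e : Term) :
    (offset env.length b e).eval inp env = sectionOffset inp b (e.eval inp env) := by
  have h : ∀ a x : ℕ, env.length + 2 = (env ++ [a, x]).length := by simp
  unfold offset sectionOffset
  simp only [eval, getD_append_length]
  congr 1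
  funext j x
  rw [h j x, eval_mul (c := inp b (x + 2))]
  · simp only [eval, getD_append_length]
  · intro j' x'
    simp only [eval, getD_append_append_length]

theorem bdd_offset {b : Bool} {e : Term} (he : e.Bdd inp B env) (heB : e.eval inp env ≤ B)
    (hc : ∀ j < e.eval inp env, inp b (sectionOffset inp b j + 3) ≤ B) :
    (offset env.length b e).Bdd inp B env := by
  refine ⟨he, heB, fun j hj => ⟨trivial, trivial, ?_⟩⟩
  have h := eval_offset (inp := inp) (env := env) b (.const j)
  unfold offset at h
  rw [h]
  have h' : env.length + 2 = (env ++ [j, sectionOffset inp b j]).length := by simp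
  rw [show (Term.const j).eval inp env = j from rfl, h']
  refine bdd_mul ⟨trivial, trivial⟩ ?_ fun _ _ => ⟨trivial, trivial⟩
  simp only [eval, getD_append_length]
  exact hc j hj

end Term

namespace Cmd
open Term

/-- A bound for all numbers in the input, where `d` is the number of variables. -/
def boundTerm (d : ℕ) : Term :=
  .add (.add (.add (.add (.add (offset d false (.load false (.const 0)))
    (offset d true (.load false (.const 0)))) (.load false (.const 0)))
      (.load false (.const 1))) (.load true (.const 1))) (.const 1)

/-- The paths. The variables are `Z` and `8 * Z ^ 3`. -/
def pathCmd : Cmd :=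
  .loop (.var 1) (.seq
    (.emit false (.var 2) (.add (.var 2) (.const 1)))
    (.loop (.var 0) (.loop (.var 0)
      (.emit true (.add (mul 5 (.var 0) (.var 2)) (.var 3))
        (.add (mul 5 (.var 0) (.add (.var 2) (.const 1))) (.var 4))))))

/-- The constraints that restrict the values of elements. -/
def elementCmd : Cmd :=
  .loop (.load false (.const 1)) (.seq
    (.emit false (mul 3 (.const 8) (.var 2)) (.add (mul 3 (.const 8) (.var 2)) (.const 3)))
    (.loop (.load true (.const 1))
      (.emit true (.add (mul 4 (.var 0) (mul 6 (.const 8) (.var 2))) (.var 3))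
        (mul 4 (.var 0) (.add (mul 6 (.const 8) (.var 2)) (.const 3))))))

/-- The constraints for an entry of a tuple. The variables are `Z`, `8 * Z ^ 3`, the number of the
symbol, its offsets, its arity, the numbers of its tuples, the number of a tuple, its position, and
the number of an entry. -/
def entryCmd : Cmd :=
  .bind (mul 11 (.const 8) (.load false (.add (.add (.var 3) (.const 4))
    (.add (mul 13 (.var 8) (.var 5)) (.var 10)))))
  (.bind (.add (.add (.var 9) (mul 12 (.const 8) (.var 10))) (.const 5)) (.seq
    (.seq (.emit false (.add (.var 9) (.const 2)) (.var 12)) (.emit false (.var 11) (.var 12)))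
    (.seq
      (.loop (.var 7)
        (.emit true (.add (mul 14 (.var 0) (.add (.var 9) (.const 2))) (.var 13))
          (.add (mul 14 (.var 0) (.var 12)) (.load true (.add (.add (.var 4) (.const 4))
            (.add (mul 14 (.var 13) (.var 5)) (.var 10)))))))
      (.loop (.load true (.const 1))
        (.emit true (.add (mul 14 (.var 0) (.var 11)) (.var 13))
          (.add (mul 14 (.var 0) (.var 12)) (.var 13)))))))

/-- The constraints for a tuple. -/
def tupleCmd : Cmd :=
  .bind (mul 9 (.const 8) (mul 11 (.var 0) (.add (mul 13 (.var 0) (.var 2)) (.var 8))))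
  (.seq
    (.seq (.emit false (.add (.var 9) (.const 2)) (.add (.var 9) (.const 7)))
      (.loop (.var 7)
        (.emit true (.add (mul 11 (.var 0) (.add (.var 9) (.const 2))) (.var 10))
          (mul 11 (.var 0) (.add (.var 9) (.const 7))))))
    (.loop (.var 5) entryCmd))

/-- The constraints for a symbol. -/
def symbolCmd : Cmd :=
  .bind (offset 3 false (.var 2)) (.bind (offset 4 true (.var 2))
    (.bind (.load false (.add (.var 3) (.const 2)))
      (.bind (.load false (.add (.var 3) (.const 3)))
        (.bind (.load true (.add (.var 4) (.const 3)))
          (.loop (.var 6) tupleCmd)))))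

/-- `8 * e ^ 3` -/
def cubeTerm (d : ℕ) (e : ℕ → Term) : Term :=
  mul d (e d) (mul (d + 2) (e (d + 2)) (mul (d + 4) (e (d + 4)) (.const 8)))

/-- All edges of the two graphs. -/
def homCmd : Cmd :=
  .bind (boundTerm 0) (.bind (cubeTerm 1 fun _ => .var 0) (.seq pathCmd (.seq elementCmd
    (.loop (.load false (.const 0)) symbolCmd))))

/-- The numbers of vertices of the two graphs. -/
def sizeTerm : Bool → Term
  | false => .add (cubeTerm 0 boundTerm) (.const 1)
  | true => mul 0 (boundTerm 0) (.add (cubeTerm 2 boundTerm) (.const 1))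

/-! ### Values of the terms and edges emitted by the commands. -/

variable {inp : Bool → ℕ → ℕ} {B : ℕ} {env : List ℕ}

theorem eval_boundTerm (inp : Bool → ℕ → ℕ) (env : List ℕ) :
    (boundTerm env.length).eval inp env = inputBound inp := by
  simp only [boundTerm, Term.eval, inputBound]
  have h0 := eval_offset (inp := inp) (env := env) false (.load false (.const 0))
  have h1 := eval_offset (inp := inp) (env := env) true (.load false (.const 0))
  simp only [Term.eval] at h0 h1
  rw [h0, h1]

theorem length_append_pair (env : List ℕ) (a x : ℕ) : (env ++ [a, x]).length = env.length + 2 := by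
  simp

/-- Each nested product adds two variables, and `boundTerm` refers to its loop variables by number;
hence the factor is given as a function of the depth. -/
theorem eval_cubeTerm {e : ℕ → Term} {c : ℕ}
    (he : ∀ env : List ℕ, (e env.length).eval inp env = c) (env : List ℕ) :
    (cubeTerm env.length e).eval inp env = 8 * c * c * c := by
  unfold cubeTerm
  rw [eval_mul (c := 8 * c * c), he]
  intro j x
  rw [← length_append_pair env j x, eval_mul (c := 8 * c), he]
  intro j' x'
  rw [show env.length + 4 = ((env ++ [j, x]) ++ [j', x']).length by simp, eval_mul (c := 8), he]
  exact fun _ _ => rfl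

theorem bdd_cubeTerm {e : ℕ → Term} {c : ℕ}
    (he : ∀ env : List ℕ, (e env.length).eval inp env = c)
    (heB : ∀ env : List ℕ, (e env.length).Bdd inp B env) (hc : c ≤ B) (env : List ℕ) :
    (cubeTerm env.length e).Bdd inp B env := by
  refine bdd_mul (heB _) (by rwa [he]) fun j x => ?_
  rw [← length_append_pair env j x]
  refine bdd_mul (heB _) (by rwa [he]) fun j' x' => ?_
  rw [show env.length + 4 = ((env ++ [j, x]) ++ [j', x']).length by simp]
  exact bdd_mul (heB _) (by rwa [he]) fun _ _ => trivial

theorem mem_out_pathCmd_false {Z S u v : ℕ} :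
    (u, v) ∈ pathCmd.out inp false [Z, S] ↔ u < S ∧ v = u + 1 := by
  simp [pathCmd, out, Term.eval]

theorem mem_out_pathCmd_true {Z S u v : ℕ} :
    (u, v) ∈ pathCmd.out inp true [Z, S] ↔
      ∃ p < S, ∃ a < Z, ∃ b < Z, u = p * Z + a ∧ v = (p + 1) * Z + b := by
  simp [pathCmd, out, Term.eval, mul, rec_add_const]

theorem mem_out_elementCmd_false {Z S u v : ℕ} :
    (u, v) ∈ elementCmd.out inp false [Z, S] ↔
      ∃ x < inp false 1, u = x * 8 ∧ v = x * 8 + 3 := by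
  simp [elementCmd, out, Term.eval, mul, rec_add_const]

theorem mem_out_elementCmd_true {Z S u v : ℕ} :
    (u, v) ∈ elementCmd.out inp true [Z, S] ↔
      ∃ x < inp false 1, ∃ a < inp true 1, u = x * 8 * Z + a ∧ v = (x * 8 + 3) * Z := by
  simp [elementCmd, out, Term.eval, mul, rec_add_const]

theorem mem_out_entryCmd_false {Z S j oM oN r cM cN t q i u v : ℕ} :
    (u, v) ∈ entryCmd.out inp false [Z, S, j, oM, oN, r, cM, cN, t, q, i] ↔
      (u = q + 2 ∧ v = q + i * 8 + 5) ∨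
        (u = inp false (oM + 4 + (r * t + i)) * 8 ∧ v = q + i * 8 + 5) := by
  simp [entryCmd, out, Term.eval, mul, rec_add_const]

theorem mem_out_entryCmd_true {Z S j oM oN r cM cN t q i u v : ℕ} :
    (u, v) ∈ entryCmd.out inp true [Z, S, j, oM, oN, r, cM, cN, t, q, i] ↔
      (∃ a < cN, u = (q + 2) * Z + a ∧
        v = (q + i * 8 + 5) * Z + inp true (oN + 4 + (r * a + i))) ∨
      ∃ a < inp true 1, u = inp false (oM + 4 + (r * t + i)) * 8 * Z + a ∧
        v = (q + i * 8 + 5) * Z + a := by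
  simp [entryCmd, out, Term.eval, mul, rec_add_const]

theorem mem_out_tupleCmd_false {Z S j oM oN r cM cN t u v : ℕ} :
    (u, v) ∈ tupleCmd.out inp false [Z, S, j, oM, oN, r, cM, cN, t] ↔
      (u = HomData.base Z j t + 2 ∧ v = HomData.base Z j t + 7) ∨
        ∃ i < r, (u, v) ∈
          entryCmd.out inp false [Z, S, j, oM, oN, r, cM, cN, t, HomData.base Z j t, i] := by
  simp [tupleCmd, out, Term.eval, mul, rec_add_const, HomData.base]

theorem mem_out_tupleCmd_true {Z S j oM oN r cM cN t u v : ℕ} :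
    (u, v) ∈ tupleCmd.out inp true [Z, S, j, oM, oN, r, cM, cN, t] ↔
      (∃ a < cN, u = (HomData.base Z j t + 2) * Z + a ∧ v = (HomData.base Z j t + 7) * Z) ∨
        ∃ i < r, (u, v) ∈
          entryCmd.out inp true [Z, S, j, oM, oN, r, cM, cN, t, HomData.base Z j t, i] := by
  simp [tupleCmd, out, Term.eval, mul, rec_add_const, HomData.base]

theorem out_symbolCmd {Z S j : ℕ} {b : Bool} :
    symbolCmd.out inp b [Z, S, j] =
      (List.range ((inputData inp).cardM j)).flatMap fun t =>
        tupleCmd.out inp b [Z, S, j, sectionOffset inp false j, sectionOffset inp true j,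
          (inputData inp).arity j, (inputData inp).cardM j, (inputData inp).cardN j, t] := by
  have h0 := eval_offset (inp := inp) (env := [Z, S, j]) false (.var 2)
  have h1 := eval_offset (inp := inp) (env := [Z, S, j, sectionOffset inp false j]) true (.var 2)
  simp [Term.eval] at h0 h1
  simp [symbolCmd, out, Term.eval, h0, h1, inputData]

theorem out_homCmd (inp : Bool → ℕ → ℕ) (b : Bool) :
    homCmd.out inp b [] =
      pathCmd.out inp b [inputBound inp, 8 * inputBound inp * inputBound inp * inputBound inp] ++
      (elementCmd.out inp b
        [inputBound inp, 8 * inputBound inp * inputBound inp * inputBound inp] ++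
      (List.range (inputData inp).k).flatMap fun j => symbolCmd.out inp b
        [inputBound inp, 8 * inputBound inp * inputBound inp * inputBound inp, j]) := by
  have h0 := eval_boundTerm inp []
  have h1 : (cubeTerm 1 fun _ => .var 0).eval inp [inputBound inp] =
      8 * inputBound inp * inputBound inp * inputBound inp := by
    simp [cubeTerm, mul, Term.eval, rec_add_const]
  rw [List.length_nil] at h0
  simp [homCmd, out, h0, h1, Term.eval, inputData]

theorem mem_out_homCmd_false (inp : Bool → ℕ → ℕ) (u v : ℕ) :
    (u, v) ∈ homCmd.out inp false [] ↔
      constraintEdge (8 * inputBound inp * inputBound inp * inputBound inp)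
        ((inputData inp).Scope (inputBound inp)) u v := by
  simp only [out_homCmd, List.mem_append, List.mem_flatMap, List.mem_range, out_symbolCmd,
    mem_out_pathCmd_false, mem_out_elementCmd_false, mem_out_tupleCmd_false,
    mem_out_entryCmd_false]
  rfl

theorem mem_out_homCmd_true (inp : Bool → ℕ → ℕ) (u v : ℕ) :
    (u, v) ∈ homCmd.out inp true [] ↔
      valueEdge (8 * inputBound inp * inputBound inp * inputBound inp) (inputBound inp)
        ((inputData inp).Allowed (inputBound inp)) u v := by
  simp only [out_homCmd, List.mem_append, List.mem_flatMap, List.mem_range, out_symbolCmd,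
    mem_out_pathCmd_true, mem_out_elementCmd_true, mem_out_tupleCmd_true,
    mem_out_entryCmd_true]
  constructor
  · rintro (⟨p, hp, a, ha, b, hb, hu, hv⟩ | ⟨x, hx, a, ha, hu, hv⟩ | ⟨j, hj, t, ht,
      ⟨a, ha, hu, hv⟩ | ⟨i, hi, ⟨a, ha, hu, hv⟩ | ⟨a, ha, hu, hv⟩⟩⟩)
    · exact ⟨p, a, p + 1, b, .inl ⟨hp, rfl, ha, hb⟩, hu, hv⟩
    · exact ⟨_, a, _, 0, .inr (.inl ⟨x, hx, rfl, rfl, ha, rfl⟩), hu, hv⟩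
    · exact ⟨_, a, _, 0, .inr (.inr ⟨j, hj, t, ht, .inl ⟨rfl, rfl, ha, rfl⟩⟩), hu, hv⟩
    · exact ⟨_, a, _, _, .inr (.inr ⟨j, hj, t, ht, .inr ⟨i, hi, .inl ⟨rfl, rfl, ha, rfl⟩⟩⟩),
        hu, hv⟩
    · exact ⟨_, a, _, _, .inr (.inr ⟨j, hj, t, ht, .inr ⟨i, hi, .inr ⟨rfl, rfl, ha, rfl⟩⟩⟩),
        hu, hv⟩
  · rintro ⟨p, a, q, b, (⟨hp, rfl, ha, hb⟩ | ⟨x, hx, rfl, rfl, ha, rfl⟩ | ⟨j, hj, t, ht,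
      ⟨rfl, rfl, ha, rfl⟩ | ⟨i, hi, ⟨rfl, rfl, ha, rfl⟩ | ⟨rfl, rfl, ha, rfl⟩⟩⟩), hu, hv⟩
    · exact .inl ⟨p, hp, a, ha, b, hb, hu, hv⟩
    · exact .inr (.inl ⟨x, hx, a, ha, hu, hv⟩)
    · exact .inr (.inr ⟨j, hj, t, ht, .inl ⟨a, ha, hu, hv⟩⟩)
    · exact .inr (.inr ⟨j, hj, t, ht, .inr ⟨i, hi, .inl ⟨a, ha, hu, hv⟩⟩⟩)
    · exact .inr (.inr ⟨j, hj, t, ht, .inr ⟨i, hi, .inr ⟨_, ha, hu, hv⟩⟩⟩)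

theorem eval_sizeTerm_false (inp : Bool → ℕ → ℕ) : (sizeTerm false).eval inp [] =
    8 * inputBound inp * inputBound inp * inputBound inp + 1 := by
  have := eval_cubeTerm (eval_boundTerm inp) []
  rw [List.length_nil] at this
  simp only [sizeTerm, Term.eval, this]

theorem eval_sizeTerm_true (inp : Bool → ℕ → ℕ) : (sizeTerm true).eval inp [] =
    (8 * inputBound inp * inputBound inp * inputBound inp + 1) * inputBound inp := by
  have h0 := eval_boundTerm inp []
  rw [List.length_nil] at h0
  have := eval_mul (inp := inp) (env := []) (e := boundTerm 0)
    (f := .add (cubeTerm 2 boundTerm) (.const 1))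
    (c := 8 * inputBound inp * inputBound inp * inputBound inp + 1) (fun j x => by
      have := eval_cubeTerm (eval_boundTerm inp) [j, x]
      simp only [List.length_cons, List.length_nil] at this
      simp only [Term.eval, List.nil_append]
      rw [this])
  rw [List.length_nil, h0] at this
  exact this

/-! ### Bounds on the lengths of the loops. -/

theorem bdd_boundTerm (hk : inp false 0 ≤ B)
    (hc : ∀ b, ∀ j < inp false 0, inp b (sectionOffset inp b j + 3) ≤ B) (env : List ℕ) :
    (boundTerm env.length).Bdd inp B env :=
  ⟨⟨⟨⟨⟨bdd_offset trivial hk (hc false), bdd_offset trivial hk (hc true)⟩, trivial⟩, trivial⟩,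
    trivial⟩, trivial⟩

theorem bdd_sizeTerm (hB : inputBound inp ≤ B)
    (hc : ∀ b, ∀ j < inp false 0, inp b (sectionOffset inp b j + 3) ≤ B) (b : Bool) :
    (sizeTerm b).Bdd inp B [] := by
  have hk : inp false 0 ≤ B := by unfold inputBound at hB; omega
  have h := bdd_boundTerm hk hc
  have h' := bdd_cubeTerm (eval_boundTerm inp) h hB
  have h0 := eval_boundTerm inp []
  rw [List.length_nil] at h0
  cases b
  · exact ⟨h' [], trivial⟩
  · exact bdd_mul (env := []) (h []) (by rw [h0]; exact hB)
      fun j x => ⟨h' [j, x], trivial⟩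

theorem bdd_entryCmd {Z S j oM oN r cM cN t q i : ℕ} (h8 : 8 ≤ B) (hZ : Z ≤ B) (hn : inp true 1 ≤ B)
    (ht : t ≤ B) (hcN : cN ≤ B) :
    entryCmd.Bdd inp B [Z, S, j, oM, oN, r, cM, cN, t, q, i] := by
  simp [entryCmd, Bdd, Term.Bdd, Term.eval, mul, rec_add_const, h8, hZ, hn, ht, hcN]
  intro j hj
  omega

theorem bdd_tupleCmd {Z S j oM oN r cM cN t : ℕ} (h8 : 8 ≤ B) (hZ : Z ≤ B) (hn : inp true 1 ≤ B)
    (ht : t ≤ B) (hcN : cN ≤ B) (hr : r ≤ B) :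
    tupleCmd.Bdd inp B [Z, S, j, oM, oN, r, cM, cN, t] := by
  simp [tupleCmd, Bdd, Term.Bdd, Term.eval, mul, rec_add_const, h8, hZ, hcN, hr,
    bdd_entryCmd h8 hZ hn ht hcN]

/-- The longest loop is the one along the path; all others run at most `inputBound inp` or 8 times.
-/
theorem bdd_homCmd (h : (inputData inp).IsBounded (inputBound inp))
    (hB : 8 * inputBound inp * inputBound inp * inputBound inp ≤ B) :
    homCmd.Bdd inp B [] := by
  have hZ : 8 * inputBound inp ≤ B := by
    refine le_trans ?_ hB
    have := h.pos
    rw [Nat.mul_assoc (8 * inputBound inp)]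
    exact Nat.le_mul_of_pos_right _ (Nat.mul_pos this this)
  have hpos := h.pos
  have hkZ := h.k_le
  have hmZ := h.m_le
  have hnZ := h.n_le
  have hcM : ∀ j < (inputData inp).k, (inputData inp).cardM j ≤ B :=
    fun j hj => (h.cardM_le j hj).trans (by omega)
  have hcN : ∀ j < (inputData inp).k, (inputData inp).cardN j ≤ B :=
    fun j hj => (h.cardN_le j hj).trans (by omega)
  have hk : inp false 0 ≤ B := by change (inputData inp).k ≤ B; omega
  have hm : inp false 1 ≤ B := by change (inputData inp).m ≤ B; omega
  have hn : inp true 1 ≤ B := by change (inputData inp).n ≤ B; omega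
  have h0 := eval_boundTerm inp []
  have h1 : (cubeTerm 1 fun _ => .var 0).eval inp [inputBound inp] =
      8 * inputBound inp * inputBound inp * inputBound inp := by
    simp [cubeTerm, mul, Term.eval, rec_add_const]
  rw [List.length_nil] at h0
  have hZ' : inputBound inp ≤ B := by omega
  refine ⟨bdd_boundTerm hk (fun b => by cases b; exacts [hcM, hcN]) [], ?_⟩
  rw [h0]
  refine ⟨?_, ?_⟩
  · simp [cubeTerm, mul, Term.Bdd, Term.eval, hZ']
  rw [List.nil_append, h1, List.singleton_append]
  refine ⟨?_, ?_, trivial, hk, fun j hj => ?_⟩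
  · simp [pathCmd, Bdd, Term.Bdd, Term.eval, mul, hZ', hB]
  · simp [elementCmd, Bdd, Term.Bdd, Term.eval, mul, hZ', hm, hn, show 8 ≤ B by omega]
  · have g0 := eval_offset (inp := inp) (env := [inputBound inp,
      8 * inputBound inp * inputBound inp * inputBound inp, j]) false (.var 2)
    have g1 := eval_offset (inp := inp) (env := [inputBound inp,
      8 * inputBound inp * inputBound inp * inputBound inp, j, sectionOffset inp false j])
      true (.var 2)
    simp [Term.eval] at g0 g1
    replace hj : j < (inputData inp).k := hj
    refine ⟨bdd_offset (env := [_, _, j]) trivial (hj.le.trans hk)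
      fun i hi => hcM i (lt_trans hi hj), ?_⟩
    simp only [List.cons_append, List.nil_append, g0]
    refine ⟨bdd_offset (env := [_, _, j, _]) trivial (hj.le.trans hk)
      fun i hi => hcN i (lt_trans hi hj), ?_⟩
    simp only [List.cons_append, List.nil_append, g1]
    refine ⟨⟨trivial, trivial⟩, ⟨trivial, trivial⟩, ⟨trivial, trivial⟩, trivial, hcM j hj,
      fun t ht => ?_⟩
    replace ht : t < (inputData inp).cardM j := ht
    -- The loop over the entries is inside the loop over the tuples, so the tuple `t` provides the
    -- nonemptiness that `arity_le` requires.
    exact bdd_tupleCmd (by omega) hZ' hn (ht.le.trans (hcM j hj)) (hcN j hj)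
      ((h.arity_le j hj (by omega)).trans hZ')

end Cmd

end RAM

/-! ### Reading the input words -/

theorem List.getElem?_flatMap_of_length {α β : Type*} {f : α → List β} {r : ℕ} (l : List α)
    (hf : ∀ x ∈ l, (f x).length = r) {t i : ℕ} (ht : t < l.length) (hi : i < r) :
    (l.flatMap f)[r * t + i]? = (f l[t])[i]? := by
  induction l generalizing t with
  | nil => simp at ht
  | cons x l ih =>
    have hx := hf x List.mem_cons_self
    rw [List.flatMap_cons]
    cases t with
    | zero => rw [List.getElem?_append_left (by omega)]; simp
    | succ t =>
      rw [List.getElem?_append_right (by rw [hx, Nat.mul_succ]; omega), hx,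
        show r * (t + 1) + i - r = r * t + i by rw [Nat.mul_succ]; omega,
        ih (fun y hy => hf y (List.mem_cons_of_mem _ hy)) (by simpa using ht)]
      simp

/-- The section of a symbol in the word of a structure. -/
def sectionWord {M : Type*} {n r : ℕ} (vert : M ≃ Fin n) (l : List (Fin r → M)) : List ℕ :=
  r :: l.length :: l.flatMap fun x => List.ofFn fun i => (vert (x i) : ℕ)

theorem length_sectionWord {M : Type*} {n r : ℕ} (vert : M ≃ Fin n) (l : List (Fin r → M)) :
    (sectionWord vert l).length = 2 + r * l.length := by
  simp [sectionWord, List.length_flatMap, Nat.mul_comm]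
  omega

theorem getElem?_sectionWord {M : Type*} {n r : ℕ} (vert : M ≃ Fin n) (l : List (Fin r → M))
    {t : ℕ} (ht : t < l.length) (i : Fin r) :
    (sectionWord vert l)[2 + (r * t + i)]? = some (vert (l[t] i) : ℕ) := by
  rw [Nat.add_comm]
  change (l.flatMap fun x => List.ofFn fun i => (vert (x i) : ℕ))[r * t + i]? = _
  rw [List.getElem?_flatMap_of_length l (fun x _ => List.length_ofFn) ht i.2]
  simp

namespace RAM

/-- Input `b` is the word that consists of `k`, `n` and the sections of the lists `T`. -/
structure Reads (inp : Bool → ℕ → ℕ) (b : Bool) {k : ℕ} (r : Fin k → ℕ) {M : Type*} {n : ℕ}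
    (vert : M ≃ Fin n) (T : (j : Fin k) → List (Fin (r j) → M)) : Prop where
  card_symbols : inp b 0 = k
  card_elements : inp b 1 = n
  arity : ∀ j : Fin k, inp b (sectionOffset inp b j + 2) = r j
  card : ∀ j : Fin k, inp b (sectionOffset inp b j + 3) = (T j).length
  entry : ∀ (j : Fin k) (t : ℕ) (ht : t < (T j).length) (i : Fin (r j)),
    inp b (sectionOffset inp b j + 4 + (r j * t + i)) = vert ((T j)[t] i)

/-- By induction on `j`, the word from cell `sectionOffset inp b j + 2` on is the list of the
remaining sections. The header of the first of them then gives the offset of the next. -/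
theorem reads_of_word {inp : Bool → ℕ → ℕ} {b : Bool} {k : ℕ} {r : Fin k → ℕ} {M : Type*} {n : ℕ}
    {vert : M ≃ Fin n} {T : (j : Fin k) → List (Fin (r j) → M)} {w : List ℕ}
    (hw : w = k :: n :: (List.finRange k).flatMap fun j => sectionWord vert (T j))
    (hinp : ∀ i, inp b i = w.getD i 0) : Reads inp b r vert T := by
  let rest : ℕ → List ℕ := fun j => ((List.finRange k).drop j).flatMap fun j =>
    sectionWord vert (T j)
  have hrest : ∀ j : Fin k, rest j = sectionWord vert (T j) ++ rest (j + 1) := by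
    intro j
    simp only [rest]
    have h : (List.finRange k)[(j : ℕ)]'(by simp) = j := by simp
    rw [List.drop_eq_getElem_cons (by simp), List.flatMap_cons, h]
  have hread : ∀ {x : List ℕ} {o : ℕ}, (∀ i, inp b (o + 2 + i) = x.getD i 0) → ∀ i y,
      x[i]? = some y → inp b (o + 2 + i) = y := by
    intro x o hx i y hy
    rw [hx, List.getD_eq_getElem?_getD, hy, Option.getD_some]
  have hstep : ∀ j : Fin k, (∀ i, inp b (sectionOffset inp b j + 2 + i) = (rest j).getD i 0) →
      inp b (sectionOffset inp b j + 2) = r j ∧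
      inp b (sectionOffset inp b j + 3) = (T j).length ∧
      ∀ (t : ℕ) (ht : t < (T j).length) (i : Fin (r j)),
        inp b (sectionOffset inp b j + 4 + (r j * t + i)) = vert ((T j)[t] i) := by
    intro j hj
    have := hread hj
    rw [hrest] at this
    refine ⟨this 0 _ rfl, this 1 _ rfl, fun t ht i => ?_⟩
    rw [← this (2 + (r j * t + i)) (vert ((T j)[t] i)), ← Nat.add_assoc _ 2]
    have h := getElem?_sectionWord vert (T j) ht i
    rw [List.getElem?_append_left ?_, h]
    -- The cell lies within the section, since otherwise the lookup `h` would return nothing.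
    by_contra hlt
    rw [List.getElem?_eq_none (by omega)] at h
    simp at h
  have hoff : ∀ j ≤ k, ∀ i, inp b (sectionOffset inp b j + 2 + i) = (rest j).getD i 0 := by
    intro j
    induction j with
    | zero =>
      intro _ i
      rw [hinp, hw, show sectionOffset inp b 0 + 2 + i = i + 2 by
        rw [Nat.add_comm]; simp [sectionOffset]]
      rfl
    | succ j ih =>
      intro hj i
      have h := ih (by omega)
      obtain ⟨h1, h2, -⟩ := hstep ⟨j, hj⟩ h
      have h3 := length_sectionWord vert (T ⟨j, hj⟩)
      have h4 := hrest ⟨j, hj⟩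
      simp only at h1 h2 h4
      rw [sectionOffset_succ, h1, h2, ← h3, Nat.add_right_comm (sectionOffset inp b j),
        Nat.add_assoc, h, h4, List.getD_append_right _ _ _ _ (by omega)]
      congr 1
      omega
  refine ⟨by rw [hinp, hw]; rfl, by rw [hinp, hw]; rfl, fun j => (hstep j (hoff j j.2.le)).1,
    fun j => (hstep j (hoff j j.2.le)).2.1, fun j => (hstep j (hoff j j.2.le)).2.2⟩

theorem Reads.sectionOffset_eq {inp : Bool → ℕ → ℕ} {b : Bool} {k : ℕ} {r : Fin k → ℕ} {M : Type*}
    {n : ℕ} {vert : M ≃ Fin n} {T : (j : Fin k) → List (Fin (r j) → M)}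
    (h : Reads inp b r vert T) :
    sectionOffset inp b k = ∑ j : Fin k, (2 + r j * (T j).length) := by
  have : ∀ j, sectionOffset inp b j = ∑ i ∈ Finset.range j,
      (2 + inp b (sectionOffset inp b i + 2) * inp b (sectionOffset inp b i + 3)) := by
    intro j
    induction j with
    | zero => rfl
    | succ j ih => rw [Finset.sum_range_succ, sectionOffset_succ, ← ih]
  rw [this, ← Fin.sum_univ_eq_sum_range (fun i =>
    2 + inp b (sectionOffset inp b i + 2) * inp b (sectionOffset inp b i + 3)) k]
  exact Finset.sum_congr rfl fun j _ => by rw [h.arity, h.card]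

/-- The product of arity and number of tuples is part of the offset, which bounds each factor when
the other is positive. For arity 0 there is at most one tuple, because the list has no repetition,
and the 2 in the offset covers it. -/
theorem Reads.section_le {inp : Bool → ℕ → ℕ} {b : Bool} {k : ℕ} {r : Fin k → ℕ} {M : Type*}
    {n : ℕ} {vert : M ≃ Fin n} {T : (j : Fin k) → List (Fin (r j) → M)}
    (h : Reads inp b r vert T) (hT : ∀ j, (T j).Nodup) (j : Fin k) :
    (T j).length ≤ sectionOffset inp b k ∧ (0 < (T j).length → r j ≤ sectionOffset inp b k) := by
  have h1 : 2 + r j * (T j).length ≤ sectionOffset inp b k := by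
    rw [h.sectionOffset_eq]
    exact Finset.single_le_sum (f := fun j => 2 + r j * (T j).length)
      (fun _ _ => Nat.zero_le _) (Finset.mem_univ j)
  refine ⟨?_, fun h0 => ?_⟩
  · rcases Nat.eq_zero_or_pos (r j) with h0 | h0
    · have : IsEmpty (Fin (r j)) := by rw [h0]; infer_instance
      let u : Unique (Fin (r j) → M) := Pi.uniqueOfIsEmpty _
      have := (hT j).length_le_card
      rw [Fintype.card_unique] at this
      omega
    · have := Nat.le_mul_of_pos_left (T j).length h0
      omega
  · have := Nat.le_mul_of_pos_right (r j) h0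
    omega

end RAM

/-! ### The input bound and the sizes of the structures. -/

theorem structureSize_eq {L : FirstOrder.Language} [Fintype (Σ l, L.Relations l)] {M : Type*}
    [L.Structure M] {k n : ℕ} (sym : Fin k ≃ Σ l, L.Relations l) (vert : M ≃ Fin n)
    {T : (j : Fin k) → List (Fin (sym j).1 → M)} (hT : ∀ j, (T j).Nodup)
    (hM : ∀ j x, x ∈ T j ↔ FirstOrder.Language.Structure.RelMap (sym j).2 x) :
    structureSize L M = k + n + ∑ j, (T j).length * (sym j).1 := by
  classical
  unfold structureSize
  have h1 : Fintype.card (Σ l, L.Relations l) = k := by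
    rw [← Fintype.card_congr sym, Fintype.card_fin]
  have h2 : Nat.card M = n := by rw [Nat.card_congr vert, Nat.card_eq_fintype_card, Fintype.card_fin]
  rw [h1, h2, ← Equiv.sum_comp sym]
  congr 1
  refine Finset.sum_congr rfl fun j _ => ?_
  congr 1
  rw [← List.toFinset_card_of_nodup (hT j), ← Set.ncard_coe_finset]
  congr 1
  ext x
  simp [hM]

namespace RAM

section

variable {L : FirstOrder.Language} {inp : Bool → ℕ → ℕ} {k m n : ℕ}
  {sym : Fin k ≃ Σ l, L.Relations l} {M N : Type*} {vM : M ≃ Fin m} {vN : N ≃ Fin n}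
  {tM : (j : Fin k) → List (Fin (sym j).1 → M)} {tN : (j : Fin k) → List (Fin (sym j).1 → N)}

theorem Reads.describes (hM : Reads inp false (fun j => (sym j).1) vM tM)
    (hN : Reads inp true (fun j => (sym j).1) vN tN) :
    (inputData inp).Describes sym vM vN tM tN where
  k_eq := hM.card_symbols
  m_eq := hM.card_elements
  n_eq := hN.card_elements
  arity_eq := hM.arity
  cardM_eq := hM.card
  cardN_eq := hN.card
  entryM_eq j t ht i := by
    rw [← hM.entry j t ht i]
    simp only [inputData, hM.arity j]
  entryN_eq j t ht i := by
    rw [← hN.entry j t ht i]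
    simp only [inputData, hM.arity j]

theorem Reads.isBounded (hM : Reads inp false (fun j => (sym j).1) vM tM)
    (hN : Reads inp true (fun j => (sym j).1) vN tN) (htM : ∀ j, (tM j).Nodup)
    (htN : ∀ j, (tN j).Nodup) : (inputData inp).IsBounded (inputBound inp) := by
  have hD := hM.describes hN
  have hZ : inputBound inp = sectionOffset inp false k + sectionOffset inp true k + k + m + n + 1 := by
    rw [inputBound, hM.card_symbols, hM.card_elements, hN.card_elements]
  rw [hZ]
  constructor
  · omega
  · rw [hD.k_eq]; omega
  · rw [hD.m_eq]; omega
  · rw [hD.n_eq]; omega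
  · intro j hj
    rw [hD.k_eq] at hj
    have := (hM.section_le htM ⟨j, hj⟩).1
    rw [hD.cardM_eq ⟨j, hj⟩]
    omega
  · intro j hj
    rw [hD.k_eq] at hj
    have := (hN.section_le htN ⟨j, hj⟩).1
    rw [hD.cardN_eq ⟨j, hj⟩]
    omega
  · intro j hj h0
    rw [hD.k_eq] at hj
    rw [hD.cardM_eq ⟨j, hj⟩] at h0
    have := (hM.section_le htM ⟨j, hj⟩).2 h0
    rw [hD.arity_eq ⟨j, hj⟩]
    omega
  · intro j hj t ht i hi
    rw [hD.k_eq] at hj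
    rw [hD.cardM_eq ⟨j, hj⟩] at ht
    rw [hD.arity_eq ⟨j, hj⟩] at hi
    rw [hD.entryM_eq ⟨j, hj⟩ t ht ⟨i, hi⟩, hD.m_eq]
    exact Fin.is_lt _
  · intro j hj t ht i hi
    rw [hD.k_eq] at hj
    rw [hD.cardN_eq ⟨j, hj⟩] at ht
    rw [hD.arity_eq ⟨j, hj⟩] at hi
    rw [hD.entryN_eq ⟨j, hj⟩ t ht ⟨i, hi⟩, hD.n_eq]
    exact Fin.is_lt _

/-- The number `k` of symbols occurs five times in the bound, twice in each total offset and once by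
itself, and twice in the sum of the sizes; so the factor 3 suffices. -/
theorem Reads.inputBound_le [Fintype (Σ l, L.Relations l)] [L.Structure M] [L.Structure N]
    (hM : Reads inp false (fun j => (sym j).1) vM tM)
    (hN : Reads inp true (fun j => (sym j).1) vN tN)
    (htM : ∀ j, (tM j).Nodup ∧
      ∀ x, x ∈ tM j ↔ FirstOrder.Language.Structure.RelMap (sym j).2 x)
    (htN : ∀ j, (tN j).Nodup ∧
      ∀ x, x ∈ tN j ↔ FirstOrder.Language.Structure.RelMap (sym j).2 x) :
    inputBound inp ≤ 3 * (structureSize L M + structureSize L N) + 1 := by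
  rw [structureSize_eq sym vM (fun j => (htM j).1) fun j => (htM j).2,
    structureSize_eq sym vN (fun j => (htN j).1) fun j => (htN j).2, inputBound, hM.card_symbols,
    hM.card_elements, hN.card_elements, hM.sectionOffset_eq, hN.sectionOffset_eq]
  simp only [Finset.sum_add_distrib, Finset.sum_const, Finset.card_univ, Fintype.card_fin,
    smul_eq_mul, Nat.mul_comm (sym _).1]
  omega

end

end RAM

/-! ### The reduction as a polynomial-time program. -/

theorem mainTheorem2 :
    ∃ (P : RAM.Prog) (p : Polynomial ℕ),
      ∀ (L : FirstOrder.Language.{u, v}) [L.IsRelational] [Fintype (Σ l, L.Relations l)]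
        (M : Type x) (N : Type y) [Finite M] [Finite N] [L.Structure M] [L.Structure N]
        (k : ℕ) (sym : Fin k ≃ Σ l, L.Relations l) (wM wN : List ℕ),
        EncodesStructure sym M wM → EncodesStructure sym N wN →
        ∃ (t : ℕ) (s : RAM.State),
          P.Exec (RAM.State.init wM wN) t s ∧
          t ≤ p.eval (structureSize L M + structureSize L N) ∧
          ∃ (a b : ℕ) (G : SimpleGraph (Fin a)) (H : SimpleGraph (Fin b)) (wG wH : List ℕ),
            EncodesGraph G wG ∧ s.Holds 2 wG ∧
            EncodesGraph H wH ∧ s.Holds 3 wH ∧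
            G.IsBipartite ∧ H.IsBipartite ∧
            (Nonempty (L.Hom M N) ↔ OrderedHom G H) := by
  obtain ⟨P, p, hP⟩ := RAM.Cmd.exists_prog RAM.Cmd.homCmd RAM.Cmd.sizeTerm
  -- The inner polynomial is `8 * B ^ 3` with `B = 3 * X + 1`, the bound on the length `8 * Z ^ 3`
  -- of the path and so on all loops.
  refine ⟨P, p.comp (8 * (3 * Polynomial.X + 1) * (3 * Polynomial.X + 1) *
    (3 * Polynomial.X + 1)), ?_⟩
  intro L _ _ M N _ _ _ _ k sym wM wN hwM hwN
  obtain ⟨m, vM, tM, htM, hwM⟩ := hwM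
  obtain ⟨n, vN, tN, htN, hwN⟩ := hwN
  have hM : RAM.Reads (RAM.inputs wM wN) false (fun j => (sym j).1) vM tM :=
    RAM.reads_of_word hwM fun _ => rfl
  have hN : RAM.Reads (RAM.inputs wM wN) true (fun j => (sym j).1) vN tN :=
    RAM.reads_of_word hwN fun _ => rfl
  have hbdd := hM.isBounded hN (fun j => (htM j).1) fun j => (htN j).1
  have hle := hM.inputBound_le hN htM htN
  obtain ⟨Z, hZ⟩ : ∃ Z, Z = RAM.inputBound (RAM.inputs wM wN) := ⟨_, rfl⟩
  obtain ⟨B, hB⟩ : ∃ B, B = 3 * (structureSize L M + structureSize L N) + 1 := ⟨_, rfl⟩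
  rw [← hZ, ← hB] at hle
  have hle' : 8 * Z * Z * Z ≤ 8 * B * B * B := by gcongr
  have hZB : Z ≤ 8 * B * B * B := by
    refine le_trans ?_ hle'
    have : 0 < Z := hZ ▸ hbdd.pos
    calc Z = 1 * 1 * 1 * Z := by simp
      _ ≤ 8 * Z * Z * Z := by gcongr <;> omega
  have hcard : ∀ b, ∀ j < RAM.inputs wM wN false 0,
      RAM.inputs wM wN b (RAM.sectionOffset (RAM.inputs wM wN) b j + 3) ≤ 8 * B * B * B := by
    intro b j hj
    refine le_trans ?_ hZB
    rw [hZ]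
    cases b
    · exact hbdd.cardM_le j hj
    · exact hbdd.cardN_le j hj
  obtain ⟨t, s, hexec, ht, hs⟩ := hP wM wN (8 * B * B * B)
    (RAM.Cmd.bdd_homCmd hbdd (by rwa [← hZ]))
    (RAM.Cmd.bdd_sizeTerm (by rwa [← hZ]) hcard)
  obtain ⟨G, H, hG, hH, hG2, hH2, hom⟩ := hbdd.isParityConstraint.exists_graphs
    (RAM.Cmd.mem_out_homCmd_false (RAM.inputs wM wN))
    (RAM.Cmd.mem_out_homCmd_true (RAM.inputs wM wN))
  refine ⟨t, s, hexec, ?_, _, _, G, H, _, _, hG, ?_, hH, ?_, hG2, hH2, ?_⟩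
  · rw [Polynomial.eval_comp]
    simpa [← hB] using ht
  · have := hs false
    rwa [RAM.Cmd.eval_sizeTerm_false] at this
  · have := hs true
    rwa [RAM.Cmd.eval_sizeTerm_true] at this
  · rw [hom, hbdd.exists_assignment_iff,
      (hM.describes hN).exists_isHom_iff (fun j => (htM j).2) fun j => (htN j).2]
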